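/- For $p=(t_p,x_p,y_p)$, $q=(t_q,x_q,y_q)$ in $\mathbb R\times\mathbb R^2$ with $t_p\le t_q$ and $v\ge 0$, the *bead* $B(p,q,v)$ is the set of all $(t,x,y)$ with $$(x-x_p)^2+(y-y_p)^2\le (t-t_p)^2v^2,\qquad (x-x_q)^2+(y-y_q)^2\le (t_q-t)^2v^2,\qquad t_p\le t\le t_q .$$ Let $\Psi_B(z;p,q,v)$ be the condition $z\in B(p,q,v)$, written out as these inequalities. Let $p_i=(t_i,x_i,y_i)$ for $i=1,2,3,4$, and let $v_1,v_2$ be speeds; these $14$ real numbers are the parameters of the following formula. **$\Phi_{\mathrm I}$ (apex containment):** $\Psi_B(p_3;p_1,p_2,v_1)\lor\Psi_B(p_4;p_1,p_2,v_1)\lor\Psi_B(p_1;p_3,p_4,v_2)\lor\Psi_B(p_2;p_3,p_4,v_2)$. **Rim against half a mantel.** For points $q=(t_q,x_q,0)$, $r=(t_r,x_r,y_r)$, $s=(t_s,x_s,y_s)$ and speeds $v,w$ put $K=v^2t_q^2-x_q^2$, $D=2v^2t_q$, $T(x)=2x\,x_q+K$, $S(x)=v^2T(x)^2-D^2x^2=v^2(-4Kx^2+4x_qKx+K^2)$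 and $$N(x)=(T(x)-Dt_r)^2w^2-D^2(x-x_r)^2-D^2y_r^2-S(x)=\alpha x^2+\beta x+\gamma,$$ where $\alpha=4x_q^2(w^2-v^2)$, $\beta=4\bigl(x_qw^2(K-Dt_r)+2v^4t_q^2x_r-v^2x_qK\bigr)$ and $\gamma=w^2(K-Dt_r)^2-4v^4t_q^2(x_r^2+y_r^2)-v^2K^2$. With $M=(2v\,y_rD)^2$ let $$Q(x)=\alpha^2x^4+2\alpha\beta x^3+(\beta^2+2\alpha\gamma+4MK)x^2+(2\beta\gamma-4Mx_qK)x+(\gamma^2-MK^2).$$ Let $H(x,Y,Z)$ be the inequality $$D\bigl(Z(2x(x_r-x_s)+x_s^2-x_r^2+y_s^2-y_r^2)+2Y(y_r-y_s)\bigr)\le Zw^2\bigl(2T(x)(t_r-t_s)+D(t_s^2-t_r^2)\bigr).$$ Then $\varphi(q,v;r,s,w)$ is the disjunction, over the at most four real roots $x$ of $Q$ (no root if $Q$ is the zero polynomial), of the conjunction of * $-4Kx^2+4x_qKx+K^2\ge 0$; * either $y_r=0$ and $\bigl(H(x,\sqrt{S(x)},D)$ or $H(x,-\sqrt{S(x)},D)\bigr)$,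 or $y_r\ne0$ and $H(x,-y_rN(x),2y_r^2D^2)$; * $0\le t_qT(x)\le 2v^2t_q^3$; * $2v^2t_q^2t_r\le t_qT(x)\le 2v^2t_q^2t_s$ or $2v^2t_q^2t_s\le t_qT(x)\le 2v^2t_q^2t_r$. **$\Phi_{\mathrm{II}}$ (rim-mantel intersection):** $v_1\ne0\land v_2\ne0\land\lnot\Phi_{\mathrm I}\land(R_{12,34}\lor R_{34,12})$. Here $R_{12,34}$ is $\varphi(p_2',v_1;p_3',p_4',v_2)\lor\varphi(p_2',v_1;p_4',p_3',v_2)$, where, if $y_1\ne y_2$, $$p'=\Bigl((t-t_1)\sqrt{(x_2-x_1)^2+(y_2-y_1)^2},\ (x-x_1)(x_2-x_1)+(y-y_1)(y_2-y_1),\ (x-x_1)(y_1-y_2)+(y-y_1)(x_2-x_1)\Bigr)$$ for $p=(t,x,y)$, and $p'=p-p_1$ if $y_1=y_2$; and $R_{34,12}$ is obtained by exchanging $(p_1,p_2,v_1)$ and $(p_3,p_4,v_2)$. **$\Phi_{\mathrm{III}}$ (initial contact):** $v_1+v_2\neq0\land\lnot\Phi_{\mathrm I}\land(C^-\lor C^+)$.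 With $d=\sqrt{(x_1-x_3)^2+(y_1-y_3)^2}$ and $\tau=d+t_1v_1+t_3v_2$, $C^-$ is the conjunction of $$t_1(v_1+v_2)\le\tau\le t_2(v_1+v_2),\qquad t_3(v_1+v_2)\le\tau\le t_4(v_1+v_2)$$ and, for $(a,b,u)=(p_1,p_2,v_1)$ and for $(a,b,u)=(p_3,p_4,v_2)$, $$\begin{aligned}&2(x_a-x_b)\bigl((x_1v_2+x_3v_1)d+v_1v_2(t_3-t_1)(x_3-x_1)\bigr)+2(y_a-y_b)\bigl((y_1v_2+y_3v_1)d+v_1v_2(t_3-t_1)(y_3-y_1)\bigr)\\&\quad+d(v_1+v_2)(x_b^2-x_a^2+y_b^2-y_a^2)\ \le\ u^2d\bigl((t_b^2-t_a^2)(v_1+v_2)+2\tau(t_a-t_b)\bigr).\end{aligned}$$ $C^+$ is $C^-$ for the time-reversed beads, i.e. with $p_1,p_2,p_3,p_4$ replaced by $\bar p_2,\bar p_1,\bar p_4,\bar p_3$, where $\overline{(t,x,y)}=(-t,x,y)$. Finally let $$\psi_{alibi}:=\lnot\Bigl(\bigl((t_1<t_2\land t_3<t_4)\land(\Phi_{\mathrm{III}}\lor\Phi_{\mathrm{II}})\bigr)\lor\Phi_{\mathrm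 I}\Bigr).$$ This is a Boolean combination, without quantifiers, of comparisons between terms built from the parameters and non-negative integer constants by addition, subtraction, multiplication and square roots, except for finite disjunctions over the real roots of quartic polynomials whose coefficients are such terms (in whose bodies the root occurs as a further variable). **Theorem.** Let $t_1\le t_2$, $t_3\le t_4$, $v_1,v_2\ge0$, and let the beads $B(p_1,p_2,v_1)$ and $B(p_3,p_4,v_2)$ be non-empty (for instance, non-degenerate). Then $\psi_{alibi}$ holds if and only if $B(p_1,p_2,v_1)\cap B(p_3,p_4,v_2)=\emptyset$. -/

import Mathlib

namespace Alibi

/-! ## Beads -/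

/-- The bead with origin `(tp, xp, yp)`, destination `(tq, xq, yq)` and maximal speed `v`, as a set of
time-space points `(t, x, y)`. -/
def bead (tp xp yp tq xq yq v : ℝ) : Set (ℝ × ℝ × ℝ) :=
  {z | (z.2.1 - xp) ^ 2 + (z.2.2 - yp) ^ 2 ≤ (z.1 - tp) ^ 2 * v ^ 2 ∧
       (z.2.1 - xq) ^ 2 + (z.2.2 - yq) ^ 2 ≤ (tq - z.1) ^ 2 * v ^ 2 ∧
       tp ≤ z.1 ∧ z.1 ≤ tq}

/-! ## Quantifier-free formulas with square roots and a choice among the roots of a quartic -/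

/-- The finite set of the (at most four) distinct real roots of `a X⁴ + b X³ + c X² + d X + e`;
it is empty when all five coefficients vanish. -/
noncomputable def quarticRoots (a b c d e : ℝ) : Finset ℝ :=
  (Polynomial.C a * Polynomial.X ^ 4 + Polynomial.C b * Polynomial.X ^ 3 +
    Polynomial.C c * Polynomial.X ^ 2 + Polynomial.C d * Polynomial.X +
    Polynomial.C e).roots.toFinset

theorem card_quarticRoots_le (a b c d e : ℝ) : (quarticRoots a b c d e).card ≤ 4 := by
  unfold quarticRoots
  refine (Multiset.toFinset_card_le _).trans ((Polynomial.card_roots' _).trans ?_)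
  compute_degree

/-- Terms in the variables `0, …, n - 1`: polynomial expressions with integer coefficients and
square roots. -/
inductive Tm (n : ℕ) : Type
  | var (i : Fin n)
  | const (k : ℕ)
  | add (s t : Tm n)
  | sub (s t : Tm n)
  | neg (s : Tm n)
  | mul (s t : Tm n)
  | pow (s : Tm n) (k : ℕ)
  | sqrt (s : Tm n)

namespace Tm

variable {n : ℕ}

instance (k : ℕ) : OfNat (Tm n) k := ⟨Tm.const k⟩
instance : Add (Tm n) := ⟨Tm.add⟩
instance : Sub (Tm n) := ⟨Tm.sub⟩
instance : Neg (Tm n) := ⟨Tm.neg⟩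
instance : Mul (Tm n) := ⟨Tm.mul⟩
instance : Pow (Tm n) ℕ := ⟨Tm.pow⟩

/-- The value of a term. -/
noncomputable def eval (env : Fin n → ℝ) : Tm n → ℝ
  | var i => env i
  | const k => (k : ℝ)
  | add s t => s.eval env + t.eval env
  | sub s t => s.eval env - t.eval env
  | neg s => -s.eval env
  | mul s t => s.eval env * t.eval env
  | pow s k => s.eval env ^ k
  | sqrt s => Real.sqrt (s.eval env)

/-- The same term, read with one more variable (the variable `n`) available. -/
def lift : Tm n → Tm (n + 1)
  | var i => var i.castSucc
  | const k => const k
  | add s t => add s.lift t.lift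
  | sub s t => sub s.lift t.lift
  | neg s => neg s.lift
  | mul s t => mul s.lift t.lift
  | pow s k => pow s.lift k
  | sqrt s => sqrt s.lift

end Tm

/-- Formulas with free variables `0, …, n - 1`: Boolean combinations of comparisons of terms, without
quantifiers. The only binder is `anyRoot a b c d e φ`, the finite disjunction of `φ` over
the real roots of the quartic with coefficients `a, b, c, d, e`; in `φ` the root is the variable `n`. -/
inductive Fm : ℕ → Type
  | le {n : ℕ} (s t : Tm n) : Fm n
  | lt {n : ℕ} (s t : Tm n) : Fm n
  | eq {n : ℕ} (s t : Tm n) : Fm n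
  | not {n : ℕ} (φ : Fm n) : Fm n
  | and {n : ℕ} (φ ψ : Fm n) : Fm n
  | or {n : ℕ} (φ ψ : Fm n) : Fm n
  | anyRoot {n : ℕ} (a b c d e : Tm n) (φ : Fm (n + 1)) : Fm n

namespace Fm

/-- Truth of a formula. -/
def Holds : {n : ℕ} → Fm n → (Fin n → ℝ) → Prop
  | _, le s t, env => s.eval env ≤ t.eval env
  | _, lt s t, env => s.eval env < t.eval env
  | _, eq s t, env => s.eval env = t.eval env
  | _, not φ, env => ¬ φ.Holds env
  | _, and φ ψ, env => φ.Holds env ∧ ψ.Holds env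
  | _, or φ ψ, env => φ.Holds env ∨ ψ.Holds env
  | _, anyRoot a b c d e φ, env =>
      ∃ r ∈ quarticRoots (a.eval env) (b.eval env) (c.eval env) (d.eval env) (e.eval env),
        φ.Holds (Fin.snoc (α := fun _ => ℝ) env r)

end Fm

/-- A time-space point `(t, x, y)` given by three terms. -/
structure Pt (n : ℕ) where
  t : Tm n
  x : Tm n
  y : Tm n

/-- A point, read with one more variable available. -/
def Pt.lift {n : ℕ} (p : Pt n) : Pt (n + 1) := ⟨p.t.lift, p.x.lift, p.y.lift⟩

/-- Reversal of time. -/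
def Pt.rev {n : ℕ} (p : Pt n) : Pt n := ⟨-p.t, p.x, p.y⟩

section Formula

variable {n : ℕ}

/-! ## `Φ_I`: an apex of one bead lies in the other bead -/

/-- `z` lies in the bead with apexes `p`, `q` and speed `v`. -/
def psiB (z p q : Pt n) (v : Tm n) : Fm n :=
  (Fm.le ((z.x - p.x) ^ 2 + (z.y - p.y) ^ 2) ((z.t - p.t) ^ 2 * v ^ 2)).and <|
  (Fm.le ((z.x - q.x) ^ 2 + (z.y - q.y) ^ 2) ((q.t - z.t) ^ 2 * v ^ 2)).and <|
  (Fm.le p.t z.t).and (Fm.le z.t q.t)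

def PhiI (p₁ p₂ : Pt n) (v₁ : Tm n) (p₃ p₄ : Pt n) (v₂ : Tm n) : Fm n :=
  ((psiB p₃ p₁ p₂ v₁).or (psiB p₄ p₁ p₂ v₁)).or ((psiB p₁ p₃ p₄ v₂).or (psiB p₂ p₃ p₄ v₂))

/-! ## `Φ_II`: the rim of one bead meets the mantel of the other bead -/

/-- The coordinates of `z` after the translation of `p` to the origin, the spatial rotation that turns the
direction from `p` to `q` into the positive `x`-direction, and the scaling by the spatial distance from `p`
to `q`. -/
def rotated (p q z : Pt n) : Pt n where
  t := (z.t - p.t) * Tm.sqrt ((q.x - p.x) ^ 2 + (q.y - p.y) ^ 2)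
  x := (z.x - p.x) * (q.x - p.x) + (z.y - p.y) * (q.y - p.y)
  y := (z.x - p.x) * (p.y - q.y) + (z.y - p.y) * (q.x - p.x)

/-- The coordinates of `z` after the translation of `p` to the origin. -/
def translated (p z : Pt n) : Pt n := ⟨z.t - p.t, z.x - p.x, z.y - p.y⟩

/-- `φ (q', r', s')` for the images `q'`, `r'`, `s'` of `q`, `r`, `s` under the change of coordinates which
moves `p` to the origin and gives `q` the `y`-coordinate zero: translation, rotation and scaling if `q` and `p`
have different `y`-coordinates, and translation only if they agree. -/
def inCoordinates (p q r s : Pt n) (φ : Pt n → Pt n → Pt n → Fm n) : Fm n :=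
  ((Fm.eq q.y p.y).not.and (φ (rotated p q q) (rotated p q r) (rotated p q s))).or
    ((Fm.eq q.y p.y).and (φ (translated p q) (translated p r) (translated p s)))

/-! From here to `phiRhoMantel`, one bead has the apexes `(0, 0, 0)` and `q` with `q.y = 0`, and the speed `v`.
On its rim, `D t = T` with `D = 2 v² q.t` and `T = 2 x q.x + K`, and `D² y² = S`. -/

/-- `K = v² q.t² - q.x²`. -/
def tmK (q : Pt n) (v : Tm n) : Tm n := v ^ 2 * q.t ^ 2 - q.x ^ 2

/-- `D = 2 v² q.t`. -/
def tmD (q : Pt n) (v : Tm n) : Tm n := 2 * v ^ 2 * q.t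

/-- `T = 2 x q.x - q.x² + v² q.t²`. -/
def tmT (x : Tm n) (q : Pt n) (v : Tm n) : Tm n := 2 * x * q.x - q.x ^ 2 + v ^ 2 * q.t ^ 2

/-- `S = v² T² - D² x²`. -/
def tmS (x : Tm n) (q : Pt n) (v : Tm n) : Tm n :=
  v ^ 2 * tmT x q v ^ 2 - tmD q v ^ 2 * x ^ 2

/-- `N = (T - D r.t)² w² - D² (x - r.x)² - D² r.y² - S`. A rim point `(t, x, y)` lies on the
double cone of speed `w` with apex `r` if and only if `-2 r.y D² y = N`. -/
def tmN (x : Tm n) (q : Pt n) (v : Tm n) (r : Pt n) (w : Tm n) : Tm n :=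
  (tmT x q v - tmD q v * r.t) ^ 2 * w ^ 2 - tmD q v ^ 2 * (x - r.x) ^ 2
    - tmD q v ^ 2 * r.y ^ 2 - tmS x q v

/-- The coefficients `α`, `β`, `γ` of `N = α x² + β x + γ`. -/
def cfA (q : Pt n) (v w : Tm n) : Tm n := 4 * q.x ^ 2 * (w ^ 2 - v ^ 2)

def cfB (q : Pt n) (v : Tm n) (r : Pt n) (w : Tm n) : Tm n :=
  4 * (q.x * w ^ 2 * (tmK q v - tmD q v * r.t) + 2 * v ^ 4 * q.t ^ 2 * r.x
    - v ^ 2 * q.x * tmK q v)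

def cfC (q : Pt n) (v : Tm n) (r : Pt n) (w : Tm n) : Tm n :=
  w ^ 2 * (tmK q v - tmD q v * r.t) ^ 2 - 4 * v ^ 4 * q.t ^ 2 * (r.x ^ 2 + r.y ^ 2)
    - v ^ 2 * tmK q v ^ 2

/-- `M = (2 v r.y D)²`. Since `S = v² (-4 K x² + 4 q.x K x + K²)`, squaring `-2 r.y D² y = N` on the rim gives the
quartic equation `N² = M (-4 K x² + 4 q.x K x + K²)`. -/
def cfM (q : Pt n) (v : Tm n) (r : Pt n) : Tm n := (2 * v * r.y * tmD q v) ^ 2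

/-- The square root of `S` exists. -/
def phiSqrt (x : Tm n) (q : Pt n) (v : Tm n) : Fm n :=
  Fm.le 0 (-(4 * tmK q v * x ^ 2) + 4 * q.x * tmK q v * x + tmK q v ^ 2)

/-- `φ` holds for one of the real roots `x` of the quartic `N² = M (-4 K x² + 4 q.x K x + K²)` for which the
square root exists. The argument of `φ` is the variable that stands for the root. -/
def phiRoots (q : Pt n) (v : Tm n) (r : Pt n) (w : Tm n) (φ : Tm (n + 1) → Fm (n + 1)) : Fm n :=
  Fm.anyRoot
    (cfA q v w ^ 2)
    (2 * cfA q v w * cfB q v r w)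
    (cfB q v r w ^ 2 + 2 * cfA q v w * cfC q v r w + 4 * cfM q v r * tmK q v)
    (2 * cfB q v r w * cfC q v r w - 4 * cfM q v r * q.x * tmK q v)
    (cfC q v r w ^ 2 - cfM q v r * tmK q v ^ 2)
    ((phiSqrt (Tm.var (Fin.last n)) q.lift v.lift).and (φ (Tm.var (Fin.last n))))

/-- For `t = T / D` and `y = Y / Z` with `D, Z > 0`, the point `(t, x, y)` lies in the half-space
`2x(r.x - s.x) + s.x² - r.x² + 2y(r.y - s.y) + s.y² - r.y² ≤ w² (2t(r.t - s.t) + s.t² - r.t²)`,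
stated after multiplication by `D Z`. -/
def psiHalf (x Y Z : Tm n) (q : Pt n) (v : Tm n) (r s : Pt n) (w : Tm n) : Fm n :=
  Fm.le
    (tmD q v * (Z * (2 * x * (r.x - s.x) + s.x ^ 2 - r.x ^ 2 + s.y ^ 2 - r.y ^ 2)
      + 2 * Y * (r.y - s.y)))
    (Z * w ^ 2 * (2 * tmT x q v * (r.t - s.t) + tmD q v * (s.t ^ 2 - r.t ^ 2)))

/-- For a root `x` of the quartic: one of the rim points with this `x`-coordinate which lie on the cone with apex
`r` lies on the corresponding half of the mantel of the bead with apexes `r` and `s` and speed `w`.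
Its `y`-coordinate is `√S / D` or `-√S / D` if `r.y = 0`, and `-N / (2 r.y D²)` if `r.y ≠ 0`. -/
def psiRhoMantel (x : Tm n) (q : Pt n) (v : Tm n) (r s : Pt n) (w : Tm n) : Fm n :=
  (((Fm.eq r.y 0).and
      ((psiHalf x (Tm.sqrt (tmS x q v)) (tmD q v) q v r s w).or
        (psiHalf x (-Tm.sqrt (tmS x q v)) (tmD q v) q v r s w))).or
    ((Fm.eq r.y 0).not.and
      (psiHalf x (-(r.y * tmN x q v r w)) (2 * r.y ^ 2 * tmD q v ^ 2) q v r s w))).and <|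
  (Fm.le 0 (q.t * tmT x q v)).and <|
  (Fm.le (q.t * tmT x q v) (2 * v ^ 2 * q.t ^ 3)).and <|
  ((Fm.le (r.t * (2 * v ^ 2 * q.t ^ 2)) (q.t * tmT x q v)).and
      (Fm.le (q.t * tmT x q v) (s.t * (2 * v ^ 2 * q.t ^ 2)))).or
    ((Fm.le (s.t * (2 * v ^ 2 * q.t ^ 2)) (q.t * tmT x q v)).and
      (Fm.le (q.t * tmT x q v) (r.t * (2 * v ^ 2 * q.t ^ 2))))

/-- The rim of the bead with apexes `(0, 0, 0)`, `q` and speed `v` meets the half of the mantel of the bead with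
apexes `r`, `s` and speed `w` that has apex `r`. -/
def phiRhoMantel (q : Pt n) (v : Tm n) (r s : Pt n) (w : Tm n) : Fm n :=
  phiRoots q v r w fun x => psiRhoMantel x q.lift v.lift r.lift s.lift w.lift

def PhiII (p₁ p₂ : Pt n) (v₁ : Tm n) (p₃ p₄ : Pt n) (v₂ : Tm n) : Fm n :=
  ((Fm.eq v₁ 0).not.and (Fm.eq v₂ 0).not).and <|
  (PhiI p₁ p₂ v₁ p₃ p₄ v₂).not.and <|
  (inCoordinates p₁ p₂ p₃ p₄ fun q r s =>
      (phiRhoMantel q v₁ r s v₂).or (phiRhoMantel q v₁ s r v₂)).or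
    (inCoordinates p₃ p₄ p₁ p₂ fun q r s =>
      (phiRhoMantel q v₂ r s v₁).or (phiRhoMantel q v₂ s r v₁))

/-! ## `Φ_III`: an initial contact lies in both beads -/

/-- The spatial distance of `p` and `r`. -/
def tmDist (p r : Pt n) : Tm n := Tm.sqrt ((p.x - r.x) ^ 2 + (p.y - r.y) ^ 2)

/-- With `d` the spatial distance of `p` and `r`, the initial contact `(t₀, x₀, y₀)` of the bottom cones with apexes
`p` and `r` and speeds `v` and `w` has `(v + w) t₀ = d + p.t v + r.t w`,
`(v + w) d x₀ = (p.x w + r.x v) d + v w (r.t - p.t) (r.x - p.x)`, and similarly for `y₀`. It satisfies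
`2x₀(a.x - b.x) + b.x² - a.x² + 2y₀(a.y - b.y) + b.y² - a.y² ≤ u² (2t₀(a.t - b.t) + b.t² - a.t²)`,
stated after multiplication by `(v + w) d`. -/
def phiMinus (p : Pt n) (v : Tm n) (r : Pt n) (w : Tm n) (a b : Pt n) (u : Tm n) : Fm n :=
  Fm.le
    (2 * (a.x - b.x) *
        ((p.x * w + r.x * v) * tmDist p r + v * ((r.t - p.t) * w) * (r.x - p.x))
      + 2 * (a.y - b.y) *
        ((p.y * w + r.y * v) * tmDist p r + v * ((r.t - p.t) * w) * (r.y - p.y))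
      + tmDist p r * (v + w) * (b.x ^ 2 - a.x ^ 2 + b.y ^ 2 - a.y ^ 2))
    (u ^ 2 * ((b.t ^ 2 - a.t ^ 2) * (v + w)
        + 2 * (tmDist p r + p.t * v + r.t * w) * (a.t - b.t)) * tmDist p r)

/-- The time `t₀` of this initial contact satisfies `a ≤ t₀ ≤ b` and `c ≤ t₀ ≤ d`. -/
def psiTime (p : Pt n) (v : Tm n) (r : Pt n) (w a b c d : Tm n) : Fm n :=
  ((Fm.le (a * (v + w)) (tmDist p r + p.t * v + r.t * w)).and
      (Fm.le (tmDist p r + p.t * v + r.t * w) (b * (v + w)))).and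
    ((Fm.le (c * (v + w)) (tmDist p r + p.t * v + r.t * w)).and
      (Fm.le (tmDist p r + p.t * v + r.t * w) (d * (v + w))))

/-- The initial contact of the bottom cones lies in both bottom-half beads. -/
def psiICMinus (p₁ p₂ : Pt n) (v₁ : Tm n) (p₃ p₄ : Pt n) (v₂ : Tm n) : Fm n :=
  (psiTime p₁ v₁ p₃ v₂ p₁.t p₂.t p₃.t p₄.t).and <|
  (phiMinus p₁ v₁ p₃ v₂ p₁ p₂ v₁).and (phiMinus p₁ v₁ p₃ v₂ p₃ p₄ v₂)

/-- The initial contact of the upper cones lies in both upper-half beads. Reversal of time turns upper cones into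
bottom cones. -/
def psiICPlus (p₁ p₂ : Pt n) (v₁ : Tm n) (p₃ p₄ : Pt n) (v₂ : Tm n) : Fm n :=
  psiICMinus p₂.rev p₁.rev v₁ p₄.rev p₃.rev v₂

def PhiIII (p₁ p₂ : Pt n) (v₁ : Tm n) (p₃ p₄ : Pt n) (v₂ : Tm n) : Fm n :=
  (Fm.eq (v₁ + v₂) 0).not.and <|
  (PhiI p₁ p₂ v₁ p₃ p₄ v₂).not.and <|
  (psiICMinus p₁ p₂ v₁ p₃ p₄ v₂).or (psiICPlus p₁ p₂ v₁ p₃ p₄ v₂)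

/-- The formula `ψ_alibi` for points and speeds that are given by terms. -/
def psiAlibiTm (p₁ p₂ : Pt n) (v₁ : Tm n) (p₃ p₄ : Pt n) (v₂ : Tm n) : Fm n :=
  ((((Fm.lt p₁.t p₂.t).and (Fm.lt p₃.t p₄.t)).and
      ((PhiIII p₁ p₂ v₁ p₃ p₄ v₂).or (PhiII p₁ p₂ v₁ p₃ p₄ v₂))).or
    (PhiI p₁ p₂ v₁ p₃ p₄ v₂)).not

end Formula

/-- The parametric formula `ψ_alibi` with the 14 free variables
`t₁, x₁, y₁, t₂, x₂, y₂, v₁, t₃, x₃, y₃, t₄, x₄, y₄, v₂`, in this order. -/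
def psiAlibi : Fm 14 :=
  psiAlibiTm ⟨.var 0, .var 1, .var 2⟩ ⟨.var 3, .var 4, .var 5⟩ (.var 6)
    ⟨.var 7, .var 8, .var 9⟩ ⟨.var 10, .var 11, .var 12⟩ (.var 13)

end Alibi

namespace Alibi

open Set Filter Topology
open scoped RealInnerProductSpace

set_option linter.unusedSectionVars false

/-! ### Cones and beads over an inner product space, and time reversal -/

section Geometry

variable {E : Type*} [NormedAddCommGroup E] [InnerProductSpace ℝ E]

/-! Let `p, q, v` and `r, s, w` be the two beads. Each disjunct of the formula describes a point (an
apex, a contact, a rim point) that lies in both beads. The substance is the converse: the beads meet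
and neither contains an apex of the other. Then both have positive duration and the speeds are not
both zero.

If one object rests, the first contact lies in both beads (`firstContact_of_rest`). Otherwise let `w
≤ v`. The intersection is compact and cut out by four convex cones. At its earliest point an
inactive cone can be dropped, since a local minimum of a linear function on a convex set is global.
So (`earliest_point_cases`) this point is the first contact, or lies on a rim and on the other
mantel, or lies only on the bottom mantel of the faster bead and the upper mantel of the slower one.
Reversing time treats the latest point. In the remaining case, sliding from these two points along
rulings of the slower bead gives two common points in the rim plane of the faster bead, on opposite
closed sides of the rim plane of the slower bead. Hence some common point lies in both planes, and
following a line in both planes to the boundary of the intersection hits a rim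
(`exists_rim_of_rimPlane`). A rim is connected and not contained in the other bead, so it meets the
other mantel. This is `contact_or_rimMantel`.

The rest is algebra. With `p` at the origin and `q` over the `x`-axis, eliminating `t` and `y` from
the equations of the rim and of the cone at `r` gives the quartic (`exists_rimPoint_iff`). A rim
point on the mantel yields a root in the formula unless the quartic is the zero polynomial. In that
case, by `exceptional_of_coeffs`, `r` is an apex of the first bead, or lies on the line of a
degenerate bead of the same speed, or is coaxial with the first bead. The first two positions
contradict the assumption on the apexes, and the third produces a contact
(`lastContact_of_coaxial`). -/

/-- The amount by which `z` misses the bottom cone with apex `p` and speed `v`. -/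
noncomputable def upGap (p : ℝ × E) (v : ℝ) (z : ℝ × E) : ℝ := ‖z.2 - p.2‖ - v * (z.1 - p.1)

/-- The amount by which `z` misses the upper cone with apex `q` and speed `v`. -/
noncomputable def downGap (q : ℝ × E) (v : ℝ) (z : ℝ × E) : ℝ := ‖z.2 - q.2‖ - v * (q.1 - z.1)

/-- The bead with apexes `p`, `q` and speed `v` over a general space. -/
def prism (p q : ℝ × E) (v : ℝ) : Set (ℝ × E) :=
  {z | upGap p v z ≤ 0 ∧ downGap q v z ≤ 0 ∧ p.1 ≤ z.1 ∧ z.1 ≤ q.1}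

/-- The rim of a bead: the points on both cones. -/
def rim (p q : ℝ × E) (v : ℝ) : Set (ℝ × E) :=
  {z | upGap p v z = 0 ∧ downGap q v z = 0}

/-- Reversal of time. -/
def rev (z : ℝ × E) : ℝ × E := (-z.1, z.2)

@[simp] theorem rev_fst (z : ℝ × E) : (rev z).1 = -z.1 := rfl
@[simp] theorem rev_snd (z : ℝ × E) : (rev z).2 = z.2 := rfl
@[simp] theorem rev_rev (z : ℝ × E) : rev (rev z) = z := by simp [rev]

/-- Time reversal exchanges bottom and upper cones, so each fact about earliest points or first
contacts carries over to latest points and last contacts. -/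
theorem upGap_rev (p z : ℝ × E) (v : ℝ) : upGap (rev p) v (rev z) = downGap p v z := by
  simp only [upGap, downGap, rev_fst, rev_snd]; ring

theorem downGap_rev (p z : ℝ × E) (v : ℝ) : downGap (rev p) v (rev z) = upGap p v z := by
  simp only [upGap, downGap, rev_fst, rev_snd]; ring

theorem upGap_rev_left (p z : ℝ × E) (v : ℝ) : upGap (rev p) v z = downGap p v (rev z) := by
  rw [← upGap_rev, rev_rev]

theorem downGap_rev_left (p z : ℝ × E) (v : ℝ) : downGap (rev p) v z = upGap p v (rev z) := by
  rw [← downGap_rev, rev_rev]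

theorem mem_prism_rev {p q z : ℝ × E} {v : ℝ} :
    z ∈ prism (rev q) (rev p) v ↔ rev z ∈ prism p q v := by
  simp only [prism, mem_ofPred_eq, upGap_rev_left, downGap_rev_left, rev_fst]
  constructor <;> rintro ⟨h₁, h₂, h₃, h₄⟩ <;> refine ⟨h₂, h₁, by linarith, by linarith⟩

theorem mem_rim_rev {p q z : ℝ × E} {v : ℝ} :
    z ∈ rim (rev q) (rev p) v ↔ rev z ∈ rim p q v := by
  simp only [rim, mem_ofPred_eq, upGap_rev_left, downGap_rev_left]
  exact and_comm

theorem fst_le_of_upGap {p z : ℝ × E} {v : ℝ} (hv : 0 < v) (h : upGap p v z ≤ 0) : p.1 ≤ z.1 := by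
  have h0 := norm_nonneg (z.2 - p.2)
  unfold upGap at h
  have : 0 ≤ v * (z.1 - p.1) := by linarith
  have := nonneg_of_mul_nonneg_right this hv
  linarith

theorem fst_le_of_downGap {p z : ℝ × E} {v : ℝ} (hv : 0 < v) (h : downGap p v z ≤ 0) :
    z.1 ≤ p.1 := by
  have := fst_le_of_upGap hv ((upGap_rev p z v).trans_le h)
  simp only [rev_fst] at this
  linarith

/-- At positive speed the cone conditions already bound the time, because norms are non-negative. At
speed zero they do not, so resting objects are treated separately. -/
theorem mem_prism_iff {p q z : ℝ × E} {v : ℝ} (hv : 0 < v) :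
    z ∈ prism p q v ↔ upGap p v z ≤ 0 ∧ downGap q v z ≤ 0 :=
  ⟨fun h => ⟨h.1, h.2.1⟩, fun h => ⟨h.1, h.2, fst_le_of_upGap hv h.1, fst_le_of_downGap hv h.2⟩⟩

theorem rim_subset_prism {p q : ℝ × E} {v : ℝ} (hv : 0 < v) : rim p q v ⊆ prism p q v :=
  fun _ h => (mem_prism_iff hv).2 ⟨h.1.le, h.2.le⟩

theorem continuous_upGap (p : ℝ × E) (v : ℝ) : Continuous (upGap p v) := by
  unfold upGap; fun_prop

theorem continuous_downGap (p : ℝ × E) (v : ℝ) : Continuous (downGap p v) := by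
  unfold downGap; fun_prop

/-- Along a segment, the gap from a bottom cone is at most the interpolated gap. -/
theorem upGap_combo_le (p z z' : ℝ × E) (v : ℝ) {a b : ℝ} (ha : 0 ≤ a) (hb : 0 ≤ b)
    (hab : a + b = 1) : upGap p v (a • z + b • z') ≤ a * upGap p v z + b * upGap p v z' := by
  have h : (a • z + b • z').2 - p.2 = a • (z.2 - p.2) + b • (z'.2 - p.2) := by
    have : p.2 = a • p.2 + b • p.2 := by rw [← add_smul, hab, one_smul]
    simp only [Prod.snd_add, Prod.smul_snd, smul_sub]
    nth_rewrite 1 [this]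
    abel
  have h' : ‖(a • z + b • z').2 - p.2‖ ≤ a * ‖z.2 - p.2‖ + b * ‖z'.2 - p.2‖ := by
    rw [h]
    refine (norm_add_le _ _).trans ?_
    rw [norm_smul, norm_smul, Real.norm_of_nonneg ha, Real.norm_of_nonneg hb]
  simp only [upGap, Prod.fst_add, Prod.smul_fst, smul_eq_mul] at h' ⊢
  obtain rfl : b = 1 - a := by linarith
  linarith

theorem downGap_combo_le (p z z' : ℝ × E) (v : ℝ) {a b : ℝ} (ha : 0 ≤ a) (hb : 0 ≤ b)
    (hab : a + b = 1) :
    downGap p v (a • z + b • z') ≤ a * downGap p v z + b * downGap p v z' := by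
  have := upGap_combo_le (rev p) (rev z) (rev z') v ha hb hab
  rw [upGap_rev, upGap_rev] at this
  rwa [← upGap_rev, show rev (a • z + b • z') = a • rev z + b • rev z' by
    simp [rev, Prod.ext_iff]; ring]

theorem convex_upGap (p : ℝ × E) (v : ℝ) : Convex ℝ {z | upGap p v z ≤ 0} := by
  intro x hx y hy a b ha hb hab
  have := upGap_combo_le p x y v ha hb hab
  have h₁ := mul_nonpos_of_nonneg_of_nonpos ha hx
  have h₂ := mul_nonpos_of_nonneg_of_nonpos hb hy
  exact this.trans (by linarith)

theorem convex_downGap (p : ℝ × E) (v : ℝ) : Convex ℝ {z | downGap p v z ≤ 0} := by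
  intro x hx y hy a b ha hb hab
  have := downGap_combo_le p x y v ha hb hab
  have h₁ := mul_nonpos_of_nonneg_of_nonpos ha hx
  have h₂ := mul_nonpos_of_nonneg_of_nonpos hb hy
  exact this.trans (by linarith)

theorem convex_prism (p q : ℝ × E) {v : ℝ} (hv : 0 < v) : Convex ℝ (prism p q v) := by
  have : prism p q v = {z | upGap p v z ≤ 0} ∩ {z | downGap q v z ≤ 0} := by
    ext z; exact mem_prism_iff hv
  rw [this]
  exact (convex_upGap p v).inter (convex_downGap q v)

theorem isCompact_prism [FiniteDimensional ℝ E] (p q : ℝ × E) {v : ℝ} (hv : 0 < v) :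
    IsCompact (prism p q v) := by
  have : ProperSpace E := FiniteDimensional.proper_real E
  have hcl : IsClosed (prism p q v) := by
    have : prism p q v = {z | upGap p v z ≤ 0} ∩ {z | downGap q v z ≤ 0} := by
      ext z; exact mem_prism_iff hv
    rw [this]
    exact (isClosed_le (continuous_upGap p v) continuous_const).inter
      (isClosed_le (continuous_downGap q v) continuous_const)
  refine (isCompact_Icc.prod (isCompact_closedBall p.2 (v * (q.1 - p.1)))).of_isClosed_subset hcl
    (s := Icc p.1 q.1 ×ˢ Metric.closedBall p.2 (v * (q.1 - p.1))) ?_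
  rintro z ⟨h₁, h₂, h₃, h₄⟩
  refine ⟨⟨h₃, h₄⟩, ?_⟩
  rw [Metric.mem_closedBall, dist_eq_norm]
  unfold upGap at h₁
  nlinarith

/-- Two discs whose centres are not further apart than the sum of the radii meet. -/
theorem exists_norm_sub_le (c d : E) {a b : ℝ} (ha : 0 ≤ a) (hb : 0 ≤ b) (h : ‖c - d‖ ≤ a + b) :
    ∃ x, ‖x - c‖ ≤ a ∧ ‖x - d‖ ≤ b := by
  obtain ⟨x, h₁, h₂⟩ := exists_dist_le_le (x := c) (z := d) ha hb
    (by rw [dist_eq_norm]; linarith)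
  exact ⟨x, by rwa [← dist_eq_norm, dist_comm], by rwa [← dist_eq_norm]⟩

/-! ### The plane of the rim -/

/-- The function that is affine and whose zero set is the plane of the rim. -/
noncomputable def rimPlane (p q : ℝ × E) (v : ℝ) (z : ℝ × E) : ℝ :=
  (‖z.2 - p.2‖ ^ 2 - (v * (z.1 - p.1)) ^ 2) - (‖z.2 - q.2‖ ^ 2 - (v * (q.1 - z.1)) ^ 2)

/-- The linear part of `rimPlane`. -/
noncomputable def rimPlaneLin (p q : ℝ × E) (v : ℝ) : (ℝ × E) →ₗ[ℝ] ℝ :=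
  (2 * v ^ 2 * (p.1 - q.1)) • LinearMap.fst ℝ ℝ E +
    ((2 : ℝ) • (innerₛₗ ℝ (q.2 - p.2))).comp (LinearMap.snd ℝ ℝ E)

/-- The quadratic terms in space and in time cancel in the difference, which makes `rimPlane`
affine. -/
theorem rimPlane_add (p q z d : ℝ × E) (v : ℝ) :
    rimPlane p q v (z + d) = rimPlane p q v z + rimPlaneLin p q v d := by
  have h₁ : (z + d).2 - p.2 = (z.2 - p.2) + d.2 := by simp; abel
  have h₂ : (z + d).2 - q.2 = (z.2 - q.2) + d.2 := by simp; abel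
  simp only [rimPlane, rimPlaneLin, h₁, h₂, norm_add_sq_real, LinearMap.add_apply,
    LinearMap.smul_apply, LinearMap.comp_apply, LinearMap.fst_apply, LinearMap.snd_apply,
    innerₛₗ_apply_apply, smul_eq_mul, Prod.fst_add, inner_sub_left]
  ring

theorem rimPlane_combo (p q z z' : ℝ × E) (v s : ℝ) :
    rimPlane p q v (z + s • (z' - z)) =
      rimPlane p q v z + s * (rimPlane p q v z' - rimPlane p q v z) := by
  have := rimPlane_add p q z (z' - z) v
  rw [add_sub_cancel] at this
  rw [rimPlane_add, map_smul, smul_eq_mul, this]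
  ring

theorem rimPlane_rev (p q z : ℝ × E) (v : ℝ) :
    rimPlane (rev q) (rev p) v (rev z) = -rimPlane p q v z := by
  simp only [rimPlane, rev_fst, rev_snd]; ring

theorem sq_sub_sq_eq_zero_iff {a b : ℝ} (ha : 0 ≤ a) (hb : 0 ≤ b) :
    a ^ 2 - b ^ 2 = 0 ↔ a - b = 0 := by
  rw [sub_eq_zero, sub_eq_zero]; exact pow_left_inj₀ ha hb two_ne_zero

theorem sq_sub_sq_neg_iff {a b : ℝ} (ha : 0 ≤ a) (hb : 0 ≤ b) :
    a ^ 2 - b ^ 2 < 0 ↔ a - b < 0 := by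
  rw [sub_neg, sub_neg]; exact pow_lt_pow_iff_left₀ ha hb two_ne_zero

/-- On the bottom cone and inside the upper one, `rimPlane` is positive. -/
theorem rimPlane_pos {p q z : ℝ × E} {v : ℝ} (h₁ : upGap p v z = 0) (h₂ : downGap q v z < 0) :
    0 < rimPlane p q v z := by
  unfold upGap at h₁; unfold downGap at h₂
  have a := norm_nonneg (z.2 - p.2)
  have b := norm_nonneg (z.2 - q.2)
  have e₁ := (sq_sub_sq_eq_zero_iff a (by linarith : 0 ≤ v * (z.1 - p.1))).2 h₁
  have e₂ := (sq_sub_sq_neg_iff b (by linarith : 0 ≤ v * (q.1 - z.1))).2 h₂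
  unfold rimPlane; linarith

/-- Inside a prism on the plane of the rim, the two gaps vanish together. -/
theorem upGap_eq_zero_iff_of_rimPlane {p q z : ℝ × E} {v : ℝ} (h₁ : upGap p v z ≤ 0)
    (h₂ : downGap q v z ≤ 0) (h : rimPlane p q v z = 0) :
    upGap p v z = 0 ↔ downGap q v z = 0 := by
  unfold upGap at *; unfold downGap at *
  have a := norm_nonneg (z.2 - p.2)
  have b := norm_nonneg (z.2 - q.2)
  rw [← sq_sub_sq_eq_zero_iff a (by linarith : 0 ≤ v * (z.1 - p.1)),
    ← sq_sub_sq_eq_zero_iff b (by linarith : 0 ≤ v * (q.1 - z.1))]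
  unfold rimPlane at h
  constructor <;> intro h' <;> linarith

/-! ### Rays from the origin of a bead and the parametrisation of its rim -/

/-- The ray of speed `v` which leaves `p` in the spatial direction `e`. -/
noncomputable def ray (p : ℝ × E) (v : ℝ) (e : E) (s : ℝ) : ℝ × E := (p.1 + s, p.2 + (v * s) • e)

theorem upGap_ray (p : ℝ × E) {v s : ℝ} {e : E} (hv : 0 ≤ v) (hs : 0 ≤ s) (he : ‖e‖ = 1) :
    upGap p v (ray p v e s) = 0 := by
  simp [upGap, ray, norm_smul, he, abs_of_nonneg hv, abs_of_nonneg hs]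

/-- The terms in `s ^ 2` cancel, so along a ray the squared gap to the upper cone is affine in `s`.
When its slope is positive, its only zero is `rimTime`. -/
theorem ray_sq (p q : ℝ × E) (v s : ℝ) {e : E} (he : ‖e‖ = 1) :
    ‖(ray p v e s).2 - q.2‖ ^ 2 - (v * (q.1 - (ray p v e s).1)) ^ 2 =
      2 * v * s * (v * (q.1 - p.1) - ⟪e, q.2 - p.2⟫) -
        ((v * (q.1 - p.1)) ^ 2 - ‖q.2 - p.2‖ ^ 2) := by
  have h : (ray p v e s).2 - q.2 = (v * s) • e - (q.2 - p.2) := by simp only [ray]; abel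
  rw [h, norm_sub_sq_real, norm_smul, he, real_inner_smul_left, mul_one, Real.norm_eq_abs, sq_abs]
  simp only [ray]
  ring

theorem exists_eq_ray {p z : ℝ × E} {v : ℝ} (hv : 0 < v) (h : upGap p v z = 0) (hz : p.1 < z.1) :
    ∃ e : E, ‖e‖ = 1 ∧ z = ray p v e (z.1 - p.1) := by
  have hpos : 0 < v * (z.1 - p.1) := mul_pos hv (by linarith)
  have hn : ‖z.2 - p.2‖ = v * (z.1 - p.1) := by unfold upGap at h; linarith
  refine ⟨(v * (z.1 - p.1))⁻¹ • (z.2 - p.2), ?_, ?_⟩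
  · rw [norm_smul, hn, Real.norm_of_nonneg (inv_nonneg.2 hpos.le), inv_mul_cancel₀ hpos.ne']
  · ext
    · simp [ray]
    · simp only [ray, smul_smul, mul_inv_cancel₀ hpos.ne', one_smul, add_sub_cancel]

theorem eq_of_upGap_of_fst {p z : ℝ × E} {v : ℝ} (h : upGap p v z ≤ 0) (hz : z.1 = p.1) :
    z = p := by
  unfold upGap at h
  rw [hz, sub_self, mul_zero, sub_zero] at h
  exact Prod.ext hz (sub_eq_zero.1 (norm_le_zero_iff.1 h))

theorem eq_of_downGap_of_fst {p z : ℝ × E} {v : ℝ} (h : downGap p v z ≤ 0) (hz : z.1 = p.1) :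
    z = p := by
  unfold downGap at h
  rw [hz, sub_self, mul_zero, sub_zero] at h
  exact Prod.ext hz (sub_eq_zero.1 (norm_le_zero_iff.1 h))

theorem norm_sub_le_of_prism {p q z : ℝ × E} {v : ℝ} (h₁ : upGap p v z ≤ 0)
    (h₂ : downGap q v z ≤ 0) : ‖q.2 - p.2‖ ≤ v * (q.1 - p.1) := by
  unfold upGap at h₁; unfold downGap at h₂
  have := norm_sub_le (z.2 - p.2) (z.2 - q.2)
  rw [show z.2 - p.2 - (z.2 - q.2) = q.2 - p.2 by abel] at this
  linarith

/-- The time that the ray from `p` in the direction `e` needs to reach the rim. -/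
noncomputable def rimTime (p q : ℝ × E) (v : ℝ) (e : E) : ℝ :=
  ((v * (q.1 - p.1)) ^ 2 - ‖q.2 - p.2‖ ^ 2) / (2 * v * (v * (q.1 - p.1) - ⟪e, q.2 - p.2⟫))

section Nondegenerate

variable {p q : ℝ × E} {v : ℝ}

theorem rimSlope_pos (h : ‖q.2 - p.2‖ < v * (q.1 - p.1)) {e : E} (he : ‖e‖ = 1) :
    0 < v * (q.1 - p.1) - ⟪e, q.2 - p.2⟫ := by
  have := real_inner_le_norm e (q.2 - p.2)
  rw [he, one_mul] at this
  linarith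

theorem rimTime_pos (hv : 0 < v) (h : ‖q.2 - p.2‖ < v * (q.1 - p.1)) {e : E} (he : ‖e‖ = 1) :
    0 < rimTime p q v e := by
  have h₁ := rimSlope_pos h he
  have h₂ := norm_nonneg (q.2 - p.2)
  refine div_pos (by nlinarith) (by positivity)

theorem rimTime_mul (hv : 0 < v) (h : ‖q.2 - p.2‖ < v * (q.1 - p.1)) {e : E} (he : ‖e‖ = 1) :
    2 * v * rimTime p q v e * (v * (q.1 - p.1) - ⟪e, q.2 - p.2⟫) =
      (v * (q.1 - p.1)) ^ 2 - ‖q.2 - p.2‖ ^ 2 := by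
  have h₁ := (rimSlope_pos h he).ne'
  have h₂ := hv.ne'
  rw [rimTime]
  field_simp

theorem ray_rimTime_mem (hv : 0 < v) (h : ‖q.2 - p.2‖ < v * (q.1 - p.1)) {e : E}
    (he : ‖e‖ = 1) : ray p v e (rimTime p q v e) ∈ rim p q v := by
  refine ⟨upGap_ray p hv.le (rimTime_pos hv h he).le he, ?_⟩
  have hsq := ray_sq p q v (rimTime p q v e) he
  have hmul := rimTime_mul hv h he
  rw [hmul, sub_self] at hsq
  refine (sq_sub_sq_eq_zero_iff (norm_nonneg _) ?_).1 hsq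
  have h₁ := rimSlope_pos h he
  -- The squared equation leaves the sign of the remaining time open. Multiplied by the positive
  -- slope and `2 * v`, that time equals this squared norm.
  have hin : 0 ≤ ‖(v * (q.1 - p.1)) • e - (q.2 - p.2)‖ ^ 2 := sq_nonneg _
  rw [norm_sub_sq_real, norm_smul, he, real_inner_smul_left, mul_one, Real.norm_eq_abs,
    sq_abs] at hin
  have : 0 ≤ (q.1 - p.1 - rimTime p q v e) * (2 * v * (v * (q.1 - p.1) - ⟪e, q.2 - p.2⟫)) := by
    linarith
  have := nonneg_of_mul_nonneg_left this (by positivity)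
  refine mul_nonneg hv.le ?_
  simp only [ray]
  linarith

theorem eq_rimTime (hv : 0 < v) (h : ‖q.2 - p.2‖ < v * (q.1 - p.1)) {e : E} (he : ‖e‖ = 1)
    {s : ℝ} (hs : ray p v e s ∈ rim p q v) : s = rimTime p q v e := by
  have hsq := ray_sq p q v s he
  have hd := hs.2
  unfold downGap at hd
  rw [sub_eq_zero.1 hd, sub_self] at hsq
  have hmul := rimTime_mul hv h he
  have h₁ := rimSlope_pos h he
  have : (2 * v * (v * (q.1 - p.1) - ⟪e, q.2 - p.2⟫)) ≠ 0 := by positivity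
  apply mul_left_cancel₀ this
  linarith

theorem rim_eq_image (hv : 0 < v) (h : ‖q.2 - p.2‖ < v * (q.1 - p.1)) :
    rim p q v = (fun e => ray p v e (rimTime p q v e)) '' Metric.sphere (0 : E) 1 := by
  ext z
  constructor
  · intro hz
    have hlt : p.1 < z.1 := by
      refine lt_of_le_of_ne (fst_le_of_upGap hv hz.1.le) fun heq => ?_
      have hzp := eq_of_upGap_of_fst hz.1.le heq.symm
      have := hz.2
      rw [hzp, downGap, norm_sub_rev] at this
      linarith
    obtain ⟨e, he, hze⟩ := exists_eq_ray hv hz.1 hlt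
    refine ⟨e, by simpa using he, ?_⟩
    have := eq_rimTime hv h he (hze ▸ hz)
    simp only
    rw [← this, ← hze]
  · rintro ⟨e, he, rfl⟩
    exact ray_rimTime_mem hv h (by simpa using he)

end Nondegenerate

/-- The rim of a degenerate bead is the whole bead. -/
theorem rim_eq_prism {p q : ℝ × E} {v : ℝ} (hv : 0 < v)
    (h : ‖q.2 - p.2‖ = v * (q.1 - p.1)) : rim p q v = prism p q v := by
  refine Subset.antisymm (rim_subset_prism hv) fun z hz => ?_
  obtain ⟨h₁, h₂, -, -⟩ := hz
  have := norm_sub_le (z.2 - p.2) (z.2 - q.2)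
  rw [show z.2 - p.2 - (z.2 - q.2) = q.2 - p.2 by abel, h] at this
  refine ⟨le_antisymm h₁ ?_, le_antisymm h₂ ?_⟩ <;> unfold upGap downGap at * <;> linarith

/-- In dimension greater than one the unit sphere of directions is connected, and `rimTime` is
continuous on it. A degenerate rim is the whole bead, hence convex. -/
theorem isPreconnected_rim (hE : 1 < Module.rank ℝ E) (p q : ℝ × E) {v : ℝ} (hv : 0 < v) :
    IsPreconnected (rim p q v) := by
  rcases (rim p q v).eq_empty_or_nonempty with h0 | ⟨z, hz⟩
  · rw [h0]; exact isPreconnected_empty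
  rcases (norm_sub_le_of_prism hz.1.le hz.2.le).lt_or_eq with h | h
  · rw [rim_eq_image hv h]
    refine (isPreconnected_sphere hE 0 1).image _ ?_
    have hden : ∀ e ∈ Metric.sphere (0 : E) 1,
        2 * v * (v * (q.1 - p.1) - ⟪e, q.2 - p.2⟫) ≠ 0 := fun e he =>
      (mul_pos (by positivity) (rimSlope_pos h (by simpa using he))).ne'
    have ht : ContinuousOn (rimTime p q v) (Metric.sphere (0 : E) 1) := by
      unfold rimTime
      exact ContinuousOn.div (by fun_prop) (by fun_prop) hden
    unfold ray
    fun_prop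
  · rw [rim_eq_prism hv h]
    exact (convex_prism p q hv).isPreconnected

/-! ### Rims that are not contained in the other bead -/

/-- A preconnected set that meets a prism and is not contained in it meets the mantel. -/
theorem exists_mantel_of_isPreconnected {s : Set (ℝ × E)} (hs : IsPreconnected s) {r t : ℝ × E}
    {w : ℝ} (hw : 0 < w) (h₁ : (s ∩ prism r t w).Nonempty) (h₂ : ¬ s ⊆ prism r t w) :
    ∃ z ∈ s, z ∈ prism r t w ∧ (upGap r w z = 0 ∨ downGap t w z = 0) := by
  obtain ⟨a, has, haB⟩ := h₁
  obtain ⟨b, hbs, hbB⟩ := not_subset.1 h₂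
  rw [mem_prism_iff hw] at haB hbB
  -- The larger of the two gaps is nonpositive exactly on the prism and zero exactly on its mantel.
  have hc : Continuous fun z => max (upGap r w z) (downGap t w z) :=
    (continuous_upGap r w).max (continuous_downGap t w)
  have ha : max (upGap r w a) (downGap t w a) ≤ 0 := max_le haB.1 haB.2
  have hb : 0 ≤ max (upGap r w b) (downGap t w b) := by
    by_contra! h
    exact hbB ⟨(le_max_left _ _).trans h.le, (le_max_right _ _).trans h.le⟩
  obtain ⟨z, hz, hz0⟩ := hs.intermediate_value has hbs hc.continuousOn ⟨ha, hb⟩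
  simp only at hz0
  refine ⟨z, hz, (mem_prism_iff hw).2 ⟨hz0 ▸ le_max_left _ _, hz0 ▸ le_max_right _ _⟩, ?_⟩
  rcases max_choice (upGap r w z) (downGap t w z) with h | h
  · exact .inl (h ▸ hz0)
  · exact .inr (h ▸ hz0)

theorem exists_unit_norm_add [Nontrivial E] (x : E) :
    ∃ e : E, ‖e‖ = 1 ∧ ∀ s : ℝ, 0 ≤ s → ‖x + s • e‖ = ‖x‖ + s := by
  rcases eq_or_ne x 0 with rfl | hx
  · obtain ⟨e, he⟩ := exists_norm_eq E zero_le_one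
    exact ⟨e, he, fun s hs => by simp [norm_smul, he, abs_of_nonneg hs]⟩
  · have hx' : 0 < ‖x‖ := norm_pos_iff.2 hx
    refine ⟨‖x‖⁻¹ • x, by simp [norm_smul, hx'.ne'], fun s hs => ?_⟩
    rw [smul_smul]
    nth_rewrite 1 [← one_smul ℝ x]
    rw [← add_smul, norm_smul, Real.norm_of_nonneg (by positivity)]
    field_simp

/-- If the first bead is at least as fast and its origin is not in the second bead, then its rim
is not contained in the second bead. -/
theorem not_rim_subset [Nontrivial E] {p q r t : ℝ × E} {v w : ℝ} (hw : 0 < w) (hwv : w ≤ v)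
    (hpq : ‖q.2 - p.2‖ ≤ v * (q.1 - p.1)) (hp : p ∉ prism r t w) : ¬ rim p q v ⊆ prism r t w := by
  have hv : 0 < v := hw.trans_le hwv
  intro hsub
  rcases hpq.lt_or_eq with h | h
  · rw [mem_prism_iff hw, not_and_or, not_le, not_le] at hp
    -- On the ray from `p` straight away from `x`, the distance to `x` grows at rate `v ≥ w`. A cone
    -- condition violated at `p` is therefore still violated where that ray meets the rim.
    have key : ∀ x : E, ∃ z ∈ rim p q v, ‖z.2 - x‖ = ‖p.2 - x‖ + v * (z.1 - p.1) ∧ p.1 < z.1 := by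
      intro x
      obtain ⟨e, he, hmul⟩ := exists_unit_norm_add (p.2 - x)
      refine ⟨_, ray_rimTime_mem hv h he, ?_, ?_⟩
      · have h0 := rimTime_pos hv h he
        have := hmul (v * rimTime p q v e) (by positivity)
        simp only [ray]
        rw [show p.2 + (v * rimTime p q v e) • e - x = p.2 - x + (v * rimTime p q v e) • e by abel,
          this]
        ring
      · have h0 := rimTime_pos hv h he
        simp only [ray]; linarith
    rcases hp with hp | hp
    · obtain ⟨z, hz, hzn, hlt⟩ := key r.2
      have := (hsub hz).1
      unfold upGap at hp this
      rw [hzn] at this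
      nlinarith
    · obtain ⟨z, hz, hzn, hlt⟩ := key t.2
      have := (hsub hz).2.1
      unfold downGap at hp this
      rw [hzn] at this
      nlinarith
  · refine hp (hsub ⟨by simp [upGap], ?_⟩)
    rw [downGap, norm_sub_rev, h, sub_self]

/-- From a point of the bottom mantel that is not on the rim one reaches the rim later. -/
theorem exists_rim_gt {p q b : ℝ × E} {v : ℝ} (hv : 0 < v) (h₁ : upGap p v b = 0)
    (h₂ : downGap q v b < 0) (hb : p.1 < b.1) : ∃ z ∈ rim p q v, b.1 < z.1 := by
  obtain ⟨e, he, hbe⟩ := exists_eq_ray hv h₁ hb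
  have hpq := norm_sub_le_of_prism h₁.le h₂.le
  have hsq := ray_sq p q v (b.1 - p.1) he
  rw [← hbe] at hsq
  unfold downGap at h₂
  have hneg := (sq_sub_sq_neg_iff (norm_nonneg _)
    (by linarith [norm_nonneg (b.2 - q.2)] : 0 ≤ v * (q.1 - b.1))).2 h₂
  have hin := real_inner_le_norm e (q.2 - p.2)
  rw [he, one_mul] at hin
  have hs : 0 < 2 * v * (b.1 - p.1) := by have := sub_pos.2 hb; positivity
  rcases hpq.lt_or_eq with h | h
  · refine ⟨_, ray_rimTime_mem hv h he, ?_⟩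
    have hmul := rimTime_mul hv h he
    have h₃ := rimSlope_pos h he
    have : (b.1 - p.1) * (2 * v * (v * (q.1 - p.1) - ⟪e, q.2 - p.2⟫)) <
        rimTime p q v e * (2 * v * (v * (q.1 - p.1) - ⟪e, q.2 - p.2⟫)) := by linarith
    have := lt_of_mul_lt_mul_right this (by positivity)
    simp only [ray]
    linarith
  -- In the degenerate case the squared gap has no constant term and is non-negative, contrary to
  -- `hneg`.
  · rw [h, sub_self, sub_zero] at hsq
    have : 0 ≤ 2 * v * (b.1 - p.1) * (v * (q.1 - p.1) - ⟪e, q.2 - p.2⟫) :=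
      mul_nonneg hs.le (by linarith)
    linarith

/-- A point of a compact set can be moved in a given direction until no further motion
is possible. -/
theorem exists_exit {s : Set (ℝ × E)} (hs : IsCompact s) {m d : ℝ × E} (hm : m ∈ s) (hd : d ≠ 0) :
    ∃ c : ℝ, m + c • d ∈ s ∧ m + c • d ∉ interior s := by
  set T : Set ℝ := (fun c : ℝ => m + c • d) ⁻¹' s with hT
  have hcont : Continuous fun c : ℝ => m + c • d := by fun_prop
  have hTc : IsCompact T := by
    refine Metric.isCompact_of_isClosed_isBounded (hs.isClosed.preimage hcont) ?_
    obtain ⟨R, hR⟩ := hs.isBounded.exists_norm_le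
    refine (Metric.isBounded_iff_subset_closedBall 0).2 ⟨(R + ‖m‖) / ‖d‖, fun c hc => ?_⟩
    have h₁ := hR _ hc
    have h₂ := norm_sub_le (m + c • d) m
    rw [add_sub_cancel_left, norm_smul] at h₂
    rw [mem_closedBall_zero_iff, le_div_iff₀ (norm_pos_iff.2 hd)]
    linarith
  obtain ⟨c, hc, hmax⟩ := hTc.exists_isMaxOn ⟨0, by simpa [hT] using hm⟩ continuousOn_id
  refine ⟨c, hc, fun hint => ?_⟩
  have hnhds : T ∈ 𝓝 c := hcont.continuousAt (mem_interior_iff_mem_nhds.1 hint)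
  obtain ⟨c', hc', hlt⟩ := Filter.Eventually.exists_gt hnhds
  exact absurd (hmax hlt) (not_le.2 hc')

/-! ### Contacts, rim-mantel points and their symmetries -/

/-- The first contact of the bottom cones lies in both beads. -/
def FirstContact (p q : ℝ × E) (v : ℝ) (r s : ℝ × E) (w : ℝ) : Prop :=
  ∃ z ∈ prism p q v, z ∈ prism r s w ∧ ‖p.2 - r.2‖ = v * (z.1 - p.1) + w * (z.1 - r.1)

/-- The last contact of the upper cones lies in both beads. -/
def LastContact (p q : ℝ × E) (v : ℝ) (r s : ℝ × E) (w : ℝ) : Prop :=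
  ∃ z ∈ prism p q v, z ∈ prism r s w ∧ ‖q.2 - s.2‖ = v * (q.1 - z.1) + w * (s.1 - z.1)

/-- The rim of the first bead meets the mantel of the second bead. -/
def RimMantel (p q : ℝ × E) (v : ℝ) (r s : ℝ × E) (w : ℝ) : Prop :=
  ∃ z ∈ rim p q v, z ∈ prism r s w ∧ (upGap r w z = 0 ∨ downGap s w z = 0)

theorem rev_mem_prism {p q z : ℝ × E} {v : ℝ} (h : z ∈ prism p q v) :
    rev z ∈ prism (rev q) (rev p) v := by
  rwa [mem_prism_rev, rev_rev]

theorem FirstContact.of_rev {p q r s : ℝ × E} {v w : ℝ}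
    (h : FirstContact (rev q) (rev p) v (rev s) (rev r) w) : LastContact p q v r s w := by
  obtain ⟨z, h₁, h₂, h₃⟩ := h
  refine ⟨rev z, mem_prism_rev.1 h₁, mem_prism_rev.1 h₂, ?_⟩
  simp only [rev_fst, rev_snd] at h₃ ⊢
  rw [h₃]; ring

theorem LastContact.of_rev {p q r s : ℝ × E} {v w : ℝ}
    (h : LastContact (rev q) (rev p) v (rev s) (rev r) w) : FirstContact p q v r s w := by
  obtain ⟨z, h₁, h₂, h₃⟩ := h
  refine ⟨rev z, mem_prism_rev.1 h₁, mem_prism_rev.1 h₂, ?_⟩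
  simp only [rev_fst, rev_snd] at h₃ ⊢
  rw [h₃]; ring

theorem RimMantel.of_rev {p q r s : ℝ × E} {v w : ℝ}
    (h : RimMantel (rev q) (rev p) v (rev s) (rev r) w) : RimMantel p q v r s w := by
  obtain ⟨z, h₁, h₂, h₃⟩ := h
  refine ⟨rev z, mem_rim_rev.1 h₁, mem_prism_rev.1 h₂, ?_⟩
  rw [upGap_rev_left, downGap_rev_left] at h₃
  exact h₃.symm

theorem FirstContact.swap {p q r s : ℝ × E} {v w : ℝ}
    (h : FirstContact p q v r s w) : FirstContact r s w p q v := by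
  obtain ⟨z, h₁, h₂, h₃⟩ := h
  exact ⟨z, h₂, h₁, by rw [norm_sub_rev, h₃]; ring⟩

theorem LastContact.swap {p q r s : ℝ × E} {v w : ℝ}
    (h : LastContact p q v r s w) : LastContact r s w p q v := by
  obtain ⟨z, h₁, h₂, h₃⟩ := h
  exact ⟨z, h₂, h₁, by rw [norm_sub_rev, h₃]; ring⟩

/-! ### Earliest and latest common points -/

/-- An earliest point of a convex set cut by inactive constraints is earliest in the whole set. -/
theorem forall_fst_le_of_eventually {W C : Set (ℝ × E)} {a : ℝ × E} (hC : Convex ℝ C)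
    (haC : a ∈ C) (hmin : ∀ z ∈ W, a.1 ≤ z.1) (hev : ∀ᶠ z in 𝓝 a, z ∈ C → z ∈ W) :
    ∀ z ∈ C, a.1 ≤ z.1 := by
  have hloc : IsLocalMinOn (fun z : ℝ × E => z.1) C a := by
    rw [IsLocalMinOn, IsMinFilter, eventually_nhdsWithin_iff]
    exact hev.mono fun z hz hzC => hmin z (hz hzC)
  have hconv : ConvexOn ℝ C (fun z : ℝ × E => z.1) :=
    (LinearMap.fst ℝ ℝ E).convexOn hC
  exact fun z hz => IsMinOn.of_isLocalMinOn_of_convexOn haC hloc hconv hz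

theorem fst_lt_of_upGap {p z : ℝ × E} {v : ℝ} (hv : 0 < v) (h : upGap p v z ≤ 0) (hz : z ≠ p) :
    p.1 < z.1 :=
  lt_of_le_of_ne (fst_le_of_upGap hv h) fun he => hz (eq_of_upGap_of_fst h he.symm)

theorem fst_lt_of_downGap {p z : ℝ × E} {v : ℝ} (hv : 0 < v) (h : downGap p v z ≤ 0)
    (hz : z ≠ p) : z.1 < p.1 :=
  lt_of_le_of_ne (fst_le_of_downGap hv h) fun he => hz (eq_of_downGap_of_fst h he)

/-- By the triangle inequality through `z`, a non-empty bead satisfies the inequality that places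
each apex in the cone of the other. -/
theorem left_mem_prism {p q z : ℝ × E} {v : ℝ} (h : z ∈ prism p q v) :
    p ∈ prism p q v := by
  have := norm_sub_le_of_prism h.1 h.2.1
  refine ⟨by simp [upGap], ?_, le_rfl, h.2.2.1.trans h.2.2.2⟩
  rw [downGap, norm_sub_rev]; linarith

theorem right_mem_prism {p q z : ℝ × E} {v : ℝ} (h : z ∈ prism p q v) :
    q ∈ prism p q v := by
  have := norm_sub_le_of_prism h.1 h.2.1
  refine ⟨?_, by simp [downGap], h.2.2.1.trans h.2.2.2, le_rfl⟩
  rw [upGap]; linarith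

/-- The earliest common point of two bottom cones is their first contact. -/
theorem norm_eq_of_forall_fst_le {p r a : ℝ × E} {v w : ℝ} (hv : 0 < v) (hw : 0 < w)
    (hp : upGap p v a ≤ 0) (hr : upGap r w a ≤ 0) (hap : a ≠ p) (har : a ≠ r)
    (hmin : ∀ z, upGap p v z ≤ 0 → upGap r w z ≤ 0 → a.1 ≤ z.1) :
    ‖p.2 - r.2‖ = v * (a.1 - p.1) + w * (a.1 - r.1) := by
  have h₁ := fst_lt_of_upGap hv hp hap
  have h₂ := fst_lt_of_upGap hw hr har
  refine le_antisymm ?_ ?_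
  · have := norm_sub_le (a.2 - r.2) (a.2 - p.2)
    rw [show a.2 - r.2 - (a.2 - p.2) = p.2 - r.2 by abel] at this
    unfold upGap at hp hr
    linarith
  · by_contra! hlt
    set δ := v * (a.1 - p.1) + w * (a.1 - r.1) - ‖p.2 - r.2‖ with hδ
    have hvw : 0 < v + w := by linarith
    -- If the two discs at the time of `a` overlap by `δ > 0`, they still meet `ε` earlier: `ε` must
    -- not go back beyond either apex, and the radii shrink by `(v + w) * ε` altogether.
    obtain ⟨ε, hε, hlt'⟩ : ∃ ε > 0, ε ≤ a.1 - p.1 ∧ ε ≤ a.1 - r.1 ∧ (v + w) * ε ≤ δ := by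
      have hδ0 : 0 < δ := by linarith
      refine ⟨min (min (a.1 - p.1) (a.1 - r.1)) (δ / (v + w)),
        lt_min (lt_min (by linarith) (by linarith)) (by positivity),
        (min_le_left _ _).trans (min_le_left _ _), (min_le_left _ _).trans (min_le_right _ _), ?_⟩
      have : min (min (a.1 - p.1) (a.1 - r.1)) (δ / (v + w)) ≤ δ / (v + w) := min_le_right _ _
      rw [le_div_iff₀ hvw] at this
      linarith
    obtain ⟨x, hx₁, hx₂⟩ := exists_norm_sub_le p.2 r.2 (a := v * (a.1 - ε - p.1))
      (b := w * (a.1 - ε - r.1)) (mul_nonneg hv.le (by linarith)) (mul_nonneg hw.le (by linarith))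
      (by linarith)
    have := hmin (a.1 - ε, x) (by simp only [upGap]; linarith) (by simp only [upGap]; linarith)
    simp only at this
    linarith

theorem eventually_upGap_le {p a : ℝ × E} {v : ℝ} (h : upGap p v a < 0) :
    ∀ᶠ z in 𝓝 a, upGap p v z ≤ 0 :=
  ((continuous_upGap p v).continuousAt.eventually_lt_const h).mono fun _ => le_of_lt

theorem eventually_downGap_le {p a : ℝ × E} {v : ℝ} (h : downGap p v a < 0) :
    ∀ᶠ z in 𝓝 a, downGap p v z ≤ 0 :=
  ((continuous_downGap p v).continuousAt.eventually_lt_const h).mono fun _ => le_of_lt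

/-- The cases are the possible sets of active cones at `a`. The last alternative is the only one
that yields no contact or rim-mantel point at `a` itself. -/
theorem earliest_point_cases {p q r s a : ℝ × E} {v w : ℝ} (hw : 0 < w) (hwv : w ≤ v)
    (hp : p ∉ prism r s w) (hr : r ∉ prism p q v) (ha₁ : a ∈ prism p q v) (ha₂ : a ∈ prism r s w)
    (hmin : ∀ z ∈ prism p q v ∩ prism r s w, a.1 ≤ z.1) :
    FirstContact p q v r s w ∨ RimMantel p q v r s w ∨ RimMantel r s w p q v ∨
      (upGap p v a = 0 ∧ downGap q v a < 0 ∧ upGap r w a < 0 ∧ downGap s w a = 0) := by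
  have hv : 0 < v := hw.trans_le hwv
  have hap : a ≠ p := fun h => hp (h ▸ ha₂)
  have har : a ≠ r := fun h => hr (h ▸ ha₁)
  have hpp := left_mem_prism ha₁
  have hrr := left_mem_prism ha₂
  have mem : ∀ {z}, upGap p v z ≤ 0 → downGap q v z ≤ 0 → upGap r w z ≤ 0 → downGap s w z ≤ 0 →
      z ∈ prism p q v ∩ prism r s w := fun h₁ h₂ h₃ h₄ =>
    ⟨(mem_prism_iff hv).2 ⟨h₁, h₂⟩, (mem_prism_iff hw).2 ⟨h₃, h₄⟩⟩
  have a₁ := ha₁.1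
  have a₂ := ha₁.2.1
  have a₃ := ha₂.1
  have a₄ := ha₂.2.1
  -- Going back in time at the same place never leaves an upper cone, so some bottom cone is active
  -- at an earliest point.
  have hlow : upGap p v a = 0 ∨ upGap r w a = 0 := by
    by_contra! h
    have h₁ := lt_of_le_of_ne a₁ h.1
    have h₃ := lt_of_le_of_ne a₃ h.2
    have := forall_fst_le_of_eventually ((convex_downGap q v).inter (convex_downGap s w))
      ⟨a₂, a₄⟩ hmin (by
        filter_upwards [eventually_upGap_le h₁, eventually_upGap_le h₃] with z h₁ h₃ hz
        exact mem h₁ hz.1 h₃ hz.2) (a.1 - 1, a.2) (by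
          simp only [downGap, mem_inter_iff, mem_ofPred_eq] at *
          constructor <;> linarith)
    simp only at this
    linarith
  rcases a₂.lt_or_eq with h₂ | h₂ <;> rcases a₄.lt_or_eq with h₄ | h₄
  · left
    refine ⟨a, ha₁, ha₂, norm_eq_of_forall_fst_le hv hw a₁ a₃ hap har fun z hz₁ hz₃ => ?_⟩
    exact forall_fst_le_of_eventually ((convex_upGap p v).inter (convex_upGap r w))
      ⟨a₁, a₃⟩ hmin (by
        filter_upwards [eventually_downGap_le h₂, eventually_downGap_le h₄] with z h₂ h₄ hz
        exact mem hz.1 h₂ hz.2 h₄) z ⟨hz₁, hz₃⟩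
  · right; right
    rcases a₃.lt_or_eq with h₃ | h₃
    · right
      exact ⟨hlow.resolve_right h₃.ne, h₂, h₃, h₄⟩
    · left
      refine ⟨a, ⟨h₃, h₄⟩, ha₁, .inl ?_⟩
      -- Otherwise both cones of the first bead are inactive, and `a` would be earliest in the whole
      -- second bead, which contains the earlier point `r`.
      by_contra h
      have h₁ := lt_of_le_of_ne a₁ h
      have := forall_fst_le_of_eventually (convex_prism r s hw) ha₂ hmin (by
        filter_upwards [eventually_upGap_le h₁, eventually_downGap_le h₂] with z h₁ h₂ hz
        exact ⟨(mem_prism_iff hv).2 ⟨h₁, h₂⟩, hz⟩) r hrr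
      exact absurd (fst_lt_of_upGap hw a₃ har) (not_lt.2 this)
  · rcases a₁.lt_or_eq with h₁ | h₁
    · have h₃ := hlow.resolve_left h₁.ne
      have := forall_fst_le_of_eventually ((convex_downGap q v).inter (convex_upGap r w))
        ⟨a₂, a₃⟩ hmin (by
          filter_upwards [eventually_upGap_le h₁, eventually_downGap_le h₄] with z h₁ h₄ hz
          exact mem h₁ hz.1 hz.2 h₄) r (by
            -- Here `w ≤ v` enters. The path from `r` through `a` to `q` never exceeds speed `v`, so
            -- `r` satisfies both remaining constraints, although it is earlier than `a`. This rules
            -- out the mirror image of the last alternative.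
            refine ⟨?_, hrr.1⟩
            have hn := norm_sub_le (a.2 - q.2) (a.2 - r.2)
            rw [show a.2 - q.2 - (a.2 - r.2) = r.2 - q.2 by abel] at hn
            have := fst_le_of_upGap hw a₃
            simp only [mem_ofPred_eq]
            unfold upGap downGap at *
            nlinarith)
      exact absurd (fst_lt_of_upGap hw a₃ har) (not_lt.2 this)
    · right; left
      refine ⟨a, ⟨h₁, h₂⟩, ha₂, .inl ?_⟩
      by_contra h
      have h₃ := lt_of_le_of_ne a₃ h
      have := forall_fst_le_of_eventually (convex_prism p q hv) ha₁ hmin (by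
        filter_upwards [eventually_upGap_le h₃, eventually_downGap_le h₄] with z h₃ h₄ hz
        exact ⟨hz, (mem_prism_iff hw).2 ⟨h₃, h₄⟩⟩) p hpp
      exact absurd (fst_lt_of_upGap hv a₁ hap) (not_lt.2 this)
  · rcases hlow with h₁ | h₃
    · exact .inr (.inl ⟨a, ⟨h₁, h₂⟩, ha₂, .inr h₄⟩)
    · exact .inr (.inr (.inl ⟨a, ⟨h₃, h₄⟩, ha₁, .inr h₂⟩))

theorem latest_point_cases {p q r s b : ℝ × E} {v w : ℝ} (hw : 0 < w) (hwv : w ≤ v)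
    (hq : q ∉ prism r s w) (hs : s ∉ prism p q v) (hb₁ : b ∈ prism p q v) (hb₂ : b ∈ prism r s w)
    (hmax : ∀ z ∈ prism p q v ∩ prism r s w, z.1 ≤ b.1) :
    LastContact p q v r s w ∨ RimMantel p q v r s w ∨ RimMantel r s w p q v ∨
      (upGap p v b < 0 ∧ downGap q v b = 0 ∧ upGap r w b = 0 ∧ downGap s w b < 0) := by
  rcases earliest_point_cases (p := rev q) (q := rev p) (r := rev s) (s := rev r) (a := rev b) hw
    hwv (by rwa [mem_prism_rev, rev_rev]) (by rwa [mem_prism_rev, rev_rev])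
    (rev_mem_prism hb₁) (rev_mem_prism hb₂) (fun z hz => by
      have := hmax (rev z) ⟨mem_prism_rev.1 hz.1, mem_prism_rev.1 hz.2⟩
      simp only [rev_fst] at this ⊢
      linarith) with h | h | h | h
  · exact .inl h.of_rev
  · exact .inr (.inl h.of_rev)
  · exact .inr (.inr (.inl h.of_rev))
  · simp only [upGap_rev, downGap_rev] at h
    exact .inr (.inr (.inr ⟨h.2.1, h.1, h.2.2.2, h.2.2.1⟩))

theorem sq_sub_sq_nonpos_of_upGap {p z : ℝ × E} {v : ℝ} (h : upGap p v z ≤ 0) :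
    ‖z.2 - p.2‖ ^ 2 - (v * (z.1 - p.1)) ^ 2 ≤ 0 := by
  unfold upGap at h
  have := pow_le_pow_left₀ (norm_nonneg (z.2 - p.2)) (sub_nonpos.1 h) 2
  linarith

/-! ### From the extreme points to both rim planes -/

/-- From a common point on the bottom mantel of the faster bead and the upper mantel of the slower
one, one can move along the latter to the plane of the rim of the former. -/
theorem exists_rimPlane_eq_zero {p q r s a : ℝ × E} {v w : ℝ} (hw : 0 < w) (hwv : w ≤ v)
    (hs : s ∉ prism p q v) (ha₁ : a ∈ prism p q v)
    (h₁ : upGap p v a = 0) (h₂ : downGap q v a < 0) (h₃ : upGap r w a < 0)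
    (h₄ : downGap s w a = 0) :
    ∃ z ∈ prism p q v ∩ prism r s w, rimPlane p q v z = 0 ∧ rimPlane r s w z ≤ 0 := by
  have hv : 0 < v := hw.trans_le hwv
  have has : a.1 < s.1 := fst_lt_of_downGap hw h₄.le fun h => hs (h ▸ ha₁)
  have haq : a.1 < q.1 := by
    refine fst_lt_of_downGap hv h₂.le fun h => h₂.ne ?_
    simp [h, downGap]
  have hns : ‖s.2 - a.2‖ = w * (s.1 - a.1) := by
    rw [norm_sub_rev]; unfold downGap at h₄; linarith
  -- The motion from `a` towards `s` has speed exactly `w`, so it leaves no bottom cone of speed at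
  -- least `w`.
  have up : ∀ (x : ℝ × E) (u : ℝ), w ≤ u → ∀ c : ℝ, 0 ≤ c →
      upGap x u (a + c • (s - a)) ≤ upGap x u a := by
    intro x u hu c hc
    have hn := norm_add_le (a.2 - x.2) (c • (s.2 - a.2))
    rw [norm_smul, Real.norm_of_nonneg hc, hns] at hn
    simp only [upGap, Prod.fst_add, Prod.snd_add, Prod.smul_fst, Prod.smul_snd, Prod.fst_sub,
      Prod.snd_sub, smul_eq_mul]
    rw [show a.2 + c • (s.2 - a.2) - x.2 = a.2 - x.2 + c • (s.2 - a.2) by abel]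
    have := mul_le_mul_of_nonneg_right hu (mul_nonneg hc (sub_nonneg.2 has.le))
    nlinarith
  have down : ∀ c : ℝ, c ≤ 1 → downGap s w (a + c • (s - a)) = 0 := by
    intro c hc
    simp only [downGap, Prod.fst_add, Prod.snd_add, Prod.smul_fst, Prod.smul_snd, Prod.fst_sub,
      Prod.snd_sub, smul_eq_mul]
    rw [show a.2 + c • (s.2 - a.2) - s.2 = -((1 - c) • (s.2 - a.2)) by
      rw [sub_smul, one_smul]; abel, norm_neg, norm_smul, Real.norm_of_nonneg (by linarith), hns]
    ring
  have hF : 0 < rimPlane p q v a := rimPlane_pos h₁ h₂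
  set D := rimPlane p q v a - rimPlane p q v s with hD
  -- `rimPlane p q v` is positive at `a`. It is nonpositive at `s` if `s` is not later than `q`,
  -- because `s` lies outside the first bead, and otherwise at the time of `q`. Being affine, it
  -- vanishes in between, at `rimPlane p q v a / D`.
  obtain ⟨μ, hμ, hμ1, hμq, hμF⟩ : ∃ μ : ℝ, 0 ≤ μ ∧ μ ≤ 1 ∧ a.1 + μ * (s.1 - a.1) ≤ q.1 ∧
      rimPlane p q v (a + μ • (s - a)) ≤ 0 := by
    rcases le_total s.1 q.1 with hsq | hsq
    · refine ⟨1, zero_le_one, le_rfl, by linarith, ?_⟩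
      have hps : upGap p v (a + (1 : ℝ) • (s - a)) ≤ 0 := (up p v hwv 1 zero_le_one).trans h₁.le
      rw [one_smul, add_sub_cancel] at hps ⊢
      have hqs : ¬ downGap q v s ≤ 0 := fun h => hs ((mem_prism_iff hv).2 ⟨hps, h⟩)
      have e₁ := sq_sub_sq_nonpos_of_upGap hps
      unfold downGap at hqs
      have e₂ := pow_le_pow_left₀ (mul_nonneg hv.le (sub_nonneg.2 hsq))
        (sub_nonneg.1 (not_le.1 hqs).le) 2
      unfold rimPlane
      linarith
    · have hsa : 0 < s.1 - a.1 := by linarith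
      have hμ0 : 0 ≤ (q.1 - a.1) / (s.1 - a.1) := div_nonneg (by linarith) hsa.le
      have hq : a.1 + (q.1 - a.1) / (s.1 - a.1) * (s.1 - a.1) = q.1 := by field_simp; ring
      refine ⟨(q.1 - a.1) / (s.1 - a.1), hμ0, (div_le_one hsa).2 (by linarith), hq.le, ?_⟩
      have e₁ := sq_sub_sq_nonpos_of_upGap ((up p v hwv _ hμ0).trans h₁.le)
      have hq' : (a + ((q.1 - a.1) / (s.1 - a.1)) • (s - a)).1 = q.1 := by simpa using hq
      unfold rimPlane
      rw [hq'] at e₁ ⊢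
      nlinarith [sq_nonneg ‖(a + ((q.1 - a.1) / (s.1 - a.1)) • (s - a)).2 - q.2‖]
  rw [rimPlane_combo] at hμF
  have hDpos : 0 < D := by
    by_contra! h
    nlinarith
  have hc0 : 0 ≤ rimPlane p q v a / D := by positivity
  have hcμ : rimPlane p q v a / D ≤ μ := by rw [div_le_iff₀ hDpos]; linarith
  set c := rimPlane p q v a / D with hc
  have z₁ : upGap p v (a + c • (s - a)) ≤ 0 := (up p v hwv c hc0).trans h₁.le
  have z₃ : upGap r w (a + c • (s - a)) ≤ 0 := (up r w le_rfl c hc0).trans h₃.le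
  have z₄ := down c (hcμ.trans hμ1)
  have zF : rimPlane p q v (a + c • (s - a)) = 0 := by
    rw [rimPlane_combo, hc]; field_simp; ring
  have z₂ : downGap q v (a + c • (s - a)) ≤ 0 := by
    have hle : 0 ≤ v * (q.1 - (a + c • (s - a)).1) := by
      refine mul_nonneg hv.le ?_
      simp only [Prod.fst_add, Prod.smul_fst, Prod.fst_sub, smul_eq_mul]
      nlinarith
    have e₁ := sq_sub_sq_nonpos_of_upGap z₁
    unfold rimPlane at zF
    exact sub_nonpos.2 ((pow_le_pow_iff_left₀ (norm_nonneg _) hle two_ne_zero).1 (by linarith))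
  refine ⟨_, ⟨(mem_prism_iff hv).2 ⟨z₁, z₂⟩, (mem_prism_iff hw).2 ⟨z₃, z₄.le⟩⟩, zF, ?_⟩
  have e₃ := sq_sub_sq_nonpos_of_upGap z₃
  unfold downGap at z₄
  unfold rimPlane
  rw [sub_eq_zero.1 z₄, sub_self, sub_zero]
  exact e₃

theorem exists_rimPlane_eq_zero' {p q r s b : ℝ × E} {v w : ℝ} (hw : 0 < w) (hwv : w ≤ v)
    (hr : r ∉ prism p q v) (hb₁ : b ∈ prism p q v)
    (h₁ : upGap p v b < 0) (h₂ : downGap q v b = 0) (h₃ : upGap r w b = 0)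
    (h₄ : downGap s w b < 0) :
    ∃ z ∈ prism p q v ∩ prism r s w, rimPlane p q v z = 0 ∧ 0 ≤ rimPlane r s w z := by
  obtain ⟨z, ⟨hz₁, hz₂⟩, hz₃, hz₄⟩ := exists_rimPlane_eq_zero (p := rev q) (q := rev p) (r := rev s)
    (s := rev r) (a := rev b) hw hwv (by rwa [mem_prism_rev, rev_rev]) (rev_mem_prism hb₁)
    (by rwa [upGap_rev]) (by rwa [downGap_rev]) (by rwa [upGap_rev]) (by rwa [downGap_rev])
  have e₁ := rimPlane_rev p q (rev z) v
  have e₂ := rimPlane_rev r s (rev z) w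
  rw [rev_rev] at e₁ e₂
  exact ⟨rev z, ⟨mem_prism_rev.1 hz₁, mem_prism_rev.1 hz₂⟩, by linarith, by linarith⟩

/-- If two compact prisms meet on the line of the two rim planes, then a rim meets the other
prism. -/
theorem exists_rim_of_rimPlane [FiniteDimensional ℝ E] (hE : 1 < Module.rank ℝ E)
    {p q r s m : ℝ × E} {v w : ℝ} (hv : 0 < v) (hw : 0 < w)
    (hm : m ∈ prism p q v ∩ prism r s w) (h₁ : rimPlane p q v m = 0) (h₂ : rimPlane r s w m = 0) :
    (rim p q v ∩ prism r s w).Nonempty ∨ (rim r s w ∩ prism p q v).Nonempty := by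
  have hrank : Module.finrank ℝ (ℝ × ℝ) < Module.finrank ℝ (ℝ × E) := by
    have : 1 < Module.finrank ℝ E := by
      rw [← Module.finrank_eq_rank] at hE; exact_mod_cast hE
    simp only [Module.finrank_prod, Module.finrank_self]
    omega
  -- Time-space has dimension at least three, so two linear forms have a common non-zero kernel
  -- vector.
  obtain ⟨d, hd, hd0⟩ := (Submodule.ne_bot_iff _).1 (LinearMap.ker_ne_bot_of_finrank_lt
    (f := (rimPlaneLin p q v).prod (rimPlaneLin r s w)) hrank)
  obtain ⟨hd₁, hd₂⟩ : rimPlaneLin p q v d = 0 ∧ rimPlaneLin r s w d = 0 := Prod.mk_eq_zero.1 hd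
  obtain ⟨c, hcW, hcint⟩ := exists_exit ((isCompact_prism p q hv).inter (isCompact_prism r s hw))
    hm hd0
  set z := m + c • d with hz
  have z₁ : rimPlane p q v z = 0 := by
    rw [hz, rimPlane_add, map_smul, hd₁, h₁, smul_zero, add_zero]
  have z₂ : rimPlane r s w z = 0 := by
    rw [hz, rimPlane_add, map_smul, hd₂, h₂, smul_zero, add_zero]
  obtain ⟨⟨g₁, g₂, -, -⟩, ⟨g₃, g₄, -, -⟩⟩ := id hcW
  have i₁ := upGap_eq_zero_iff_of_rimPlane g₁ g₂ z₁
  have i₂ := upGap_eq_zero_iff_of_rimPlane g₃ g₄ z₂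
  by_cases c₁ : upGap p v z = 0
  · exact .inl ⟨z, ⟨c₁, i₁.1 c₁⟩, hcW.2⟩
  by_cases c₃ : upGap r w z = 0
  · exact .inr ⟨z, ⟨c₃, i₂.1 c₃⟩, hcW.1⟩
  -- On a rim plane the two gaps of a bead vanish together. If neither rim is hit, all four gaps are
  -- negative and the exit point would be interior.
  refine absurd (mem_interior_iff_mem_nhds.2 ?_) hcint
  filter_upwards [eventually_upGap_le (lt_of_le_of_ne g₁ c₁),
    eventually_downGap_le (lt_of_le_of_ne g₂ (mt i₁.2 c₁)),
    eventually_upGap_le (lt_of_le_of_ne g₃ c₃),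
    eventually_downGap_le (lt_of_le_of_ne g₄ (mt i₂.2 c₃))] with y k₁ k₂ k₃ k₄
  exact ⟨(mem_prism_iff hv).2 ⟨k₁, k₂⟩, (mem_prism_iff hw).2 ⟨k₃, k₄⟩⟩

/-- Two prisms of positive speed, the first at least as fast as the second. -/
theorem contact_or_rimMantel_of_le [FiniteDimensional ℝ E] (hE : 1 < Module.rank ℝ E)
    {p q r s : ℝ × E} {v w : ℝ} (hw : 0 < w) (hwv : w ≤ v)
    (hp : p ∉ prism r s w) (hq : q ∉ prism r s w) (hr : r ∉ prism p q v) (hs : s ∉ prism p q v)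
    (hW : (prism p q v ∩ prism r s w).Nonempty) :
    FirstContact p q v r s w ∨ LastContact p q v r s w ∨ RimMantel p q v r s w ∨
      RimMantel r s w p q v := by
  have hv : 0 < v := hw.trans_le hwv
  have : Nontrivial E := (rank_pos_iff_nontrivial (R := ℝ)).1 (zero_lt_one.trans hE)
  have hc := (isCompact_prism p q hv).inter (isCompact_prism r s hw)
  obtain ⟨a, ha, hmin⟩ := hc.exists_isMinOn hW (continuous_fst (X := ℝ) (Y := E)).continuousOn
  obtain ⟨b, hb, hmax⟩ := hc.exists_isMaxOn hW (continuous_fst (X := ℝ) (Y := E)).continuousOn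
  rcases earliest_point_cases hw hwv hp hr ha.1 ha.2 (fun z hz => hmin hz) with h | h | h | haa
  · exact .inl h
  · exact .inr (.inr (.inl h))
  · exact .inr (.inr (.inr h))
  rcases latest_point_cases hw hwv hq hs hb.1 hb.2 (fun z hz => hmax hz) with h | h | h | hbb
  · exact .inr (.inl h)
  · exact .inr (.inr (.inl h))
  · exact .inr (.inr (.inr h))
  obtain ⟨a', ha', ha₁, ha₂⟩ := exists_rimPlane_eq_zero hw hwv hs ha.1 haa.1 haa.2.1 haa.2.2.1
    haa.2.2.2
  obtain ⟨b', hb', hb₁, hb₂⟩ := exists_rimPlane_eq_zero' hw hwv hr hb.1 hbb.1 hbb.2.1 hbb.2.2.1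
    hbb.2.2.2
  -- The segment from `a'` to `b'` stays in the rim plane of the faster bead and crosses that of the
  -- slower one.
  obtain ⟨m, hm, hm₁, hm₂⟩ : ∃ m ∈ prism p q v ∩ prism r s w, rimPlane p q v m = 0 ∧
      rimPlane r s w m = 0 := by
    have hconv := (convex_prism p q hv).inter (convex_prism r s hw)
    have hcont : ContinuousOn (rimPlane r s w) (segment ℝ a' b') := by
      unfold rimPlane; fun_prop
    obtain ⟨m, hm, hm₂⟩ := (convex_segment a' b').isPreconnected.intermediate_value
      (left_mem_segment ℝ a' b') (right_mem_segment ℝ a' b') hcont ⟨ha₂, hb₂⟩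
    refine ⟨m, hconv.segment_subset ha' hb' hm, ?_, hm₂⟩
    rw [segment_eq_image'] at hm
    obtain ⟨θ, -, rfl⟩ := hm
    simp only
    rw [rimPlane_combo, ha₁, hb₁]; ring
  rcases exists_rim_of_rimPlane hE hv hw hm hm₁ hm₂ with h | h
  · exact .inr (.inr (.inl (exists_mantel_of_isPreconnected (isPreconnected_rim hE p q hv) hw h
      (not_rim_subset hw hwv (norm_sub_le_of_prism ha.1.1 ha.1.2.1) hp))))
  · refine .inr (.inr (.inr (exists_mantel_of_isPreconnected (isPreconnected_rim hE r s hw) hv h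
      fun hsub => ?_)))
    -- Since `a` is on the upper mantel of the slower bead but off its rim, that rim has a point
    -- earlier than `a`. By minimality of `a` this point is outside the faster bead.
    obtain ⟨z, hz, hlt⟩ := exists_rim_gt (p := rev s) (q := rev r) (b := rev a) hw
      (by rw [upGap_rev]; exact haa.2.2.2) (by rw [downGap_rev]; exact haa.2.2.1) (by
        have := fst_lt_of_downGap hw haa.2.2.2.le fun h => hs (h ▸ ha.1)
        simpa using this)
    have hz' := mem_rim_rev.1 hz
    have : a.1 ≤ (rev z).1 := hmin ⟨hsub hz', rim_subset_prism hw hz'⟩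
    simp only [rev_fst] at this hlt
    linarith

/-! ### Resting objects and the combined geometric statement -/

/-- A resting object meets the other bead at the first contact. -/
theorem firstContact_of_rest {p q r s z : ℝ × E} {w : ℝ} (hw : 0 < w) (hp : p ∉ prism r s w)
    (h₁ : z ∈ prism p q 0) (h₂ : z ∈ prism r s w) : FirstContact p q 0 r s w := by
  have hzp : z.2 = p.2 := by
    have := h₁.1
    rw [upGap, zero_mul, sub_zero] at this
    exact sub_eq_zero.1 (norm_le_zero_iff.1 this)
  obtain ⟨g₁, g₂, g₃, g₄⟩ := h₁
  obtain ⟨k₁, k₂, k₃, k₄⟩ := h₂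
  unfold upGap downGap at *
  rw [zero_mul, sub_zero] at g₁ g₂
  rw [hzp] at g₁ g₂ k₁ k₂
  -- The first time at which the cone of `r` reaches the place of the resting object. Were it before
  -- `p.1`, the apex `p` would lie in the second bead.
  set t := r.1 + ‖p.2 - r.2‖ / w with ht
  have hwt : w * (t - r.1) = ‖p.2 - r.2‖ := by rw [ht]; field_simp; ring
  have hn := norm_nonneg (p.2 - r.2)
  have htz : t ≤ z.1 := by nlinarith
  have hrt : r.1 ≤ t := by nlinarith
  have hpt : p.1 ≤ t := by
    by_contra! h
    refine hp ⟨?_, ?_, by linarith, by linarith⟩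
    · unfold upGap; nlinarith
    · unfold downGap; nlinarith
  refine ⟨(t, p.2), ⟨?_, ?_, hpt, htz.trans g₄⟩, ⟨?_, ?_, hrt, htz.trans k₄⟩, ?_⟩
  · simp [upGap]
  · simpa [downGap] using g₂
  · simp only [upGap]; linarith
  · simp only [downGap]; nlinarith
  · simp only; linarith

/-- Two intersecting beads of which none contains an apex of the other: a contact lies in both, or
the rim of one of them meets the mantel of the other. -/
theorem contact_or_rimMantel [FiniteDimensional ℝ E] (hE : 1 < Module.rank ℝ E)
    {p q r s : ℝ × E} {v w : ℝ} (hv : 0 ≤ v) (hw : 0 ≤ w) (hvw : v + w ≠ 0)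
    (hp : p ∉ prism r s w) (hq : q ∉ prism r s w) (hr : r ∉ prism p q v) (hs : s ∉ prism p q v)
    (hW : (prism p q v ∩ prism r s w).Nonempty) :
    FirstContact p q v r s w ∨ LastContact p q v r s w ∨
      (0 < v ∧ 0 < w ∧ (RimMantel p q v r s w ∨ RimMantel r s w p q v)) := by
  rcases hv.eq_or_lt with rfl | hv
  · have hw : 0 < w := lt_of_le_of_ne hw (by simpa using hvw.symm)
    obtain ⟨z, h₁, h₂⟩ := hW
    exact .inl (firstContact_of_rest hw hp h₁ h₂)
  rcases hw.eq_or_lt with rfl | hw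
  · obtain ⟨z, h₁, h₂⟩ := hW
    exact .inl (firstContact_of_rest hv hr h₂ h₁).swap
  rcases le_total w v with h | h
  · rcases contact_or_rimMantel_of_le hE hw h hp hq hr hs hW with h | h | h | h
    · exact .inl h
    · exact .inr (.inl h)
    · exact .inr (.inr ⟨hv, hw, .inl h⟩)
    · exact .inr (.inr ⟨hv, hw, .inr h⟩)
  · rcases contact_or_rimMantel_of_le hE hv h hr hs hp hq (by rwa [inter_comm]) with h | h | h | h
    · exact .inl h.swap
    · exact .inr (.inl h.swap)
    · exact .inr (.inr ⟨hv, hw, .inr h⟩)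
    · exact .inr (.inr ⟨hv, hw, .inl h⟩)

/-! ### Geometry of the exceptional positions -/

/-- If the origins of two beads and the destination of the first have the same place, and the rim of
the first lies on the bottom cone of the second, then a common point on the rim of the first
bead yields a last contact in both. -/
theorem lastContact_of_coaxial {p q r s z : ℝ × E} {v w : ℝ} (hv : 0 < v) (hw : 0 < w)
    (hpq : q.2 = p.2) (hpr : r.2 = p.2) (hrim : w * |p.1 + q.1 - 2 * r.1| = v * (q.1 - p.1))
    (hq : q ∉ prism r s w) (hs : s ∉ prism p q v)
    (hz₁ : z ∈ rim p q v) (hz₂ : z ∈ prism r s w) : LastContact p q v r s w := by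
  obtain ⟨z₁, z₂⟩ := hz₁
  obtain ⟨z₃, z₄, z₅, z₆⟩ := hz₂
  unfold upGap downGap at *
  rw [hpq] at z₂
  -- The rim of a bead over a single place is a circle at half time.
  have hzt : 2 * z.1 = p.1 + q.1 := by
    have : v * (2 * z.1 - (p.1 + q.1)) = 0 := by linarith
    have := (mul_eq_zero.1 this).resolve_left hv.ne'
    linarith
  have hpqt : p.1 ≤ q.1 := by
    have := norm_nonneg (z.2 - p.2)
    nlinarith
  rw [abs_of_nonneg (by linarith)] at hrim
  set d := ‖q.2 - s.2‖ with hd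
  have hd0 : 0 ≤ d := norm_nonneg _
  have hds : d ≤ v * (q.1 - z.1) + w * (s.1 - z.1) := by
    have := norm_sub_le (z.2 - s.2) (z.2 - p.2)
    rw [show z.2 - s.2 - (z.2 - p.2) = q.2 - s.2 by rw [hpq]; abel] at this
    linarith
  have hqd : w * (s.1 - q.1) ≤ d := by
    by_contra! h
    have : 0 < s.1 - q.1 := by
      by_contra! h'
      nlinarith
    refine hq ⟨?_, ?_, by linarith, by linarith⟩
    · rw [upGap, hpq, hpr, sub_self, norm_zero]; nlinarith
    · rw [downGap]; linarith
  have hsd : v * (q.1 - s.1) ≤ d := by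
    by_contra! h
    have : 0 < q.1 - s.1 := by
      by_contra! h'
      nlinarith
    have hsn : ‖s.2 - q.2‖ = d := norm_sub_rev _ _
    refine hs ⟨?_, ?_, by linarith, by linarith⟩
    · rw [upGap, ← hpq, hsn]; nlinarith
    · rw [downGap, hsn]; linarith
  have hvw : 0 < v + w := by linarith
  -- The time of the last contact. `hqd` and `hsd` put it no later than `q.1` and `s.1`, and `hds`
  -- no earlier than `z.1`. From `z.1` on, both bottom cones contain the upper cone of `q`.
  set t := (v * q.1 + w * s.1 - d) / (v + w) with ht
  have htm : (v + w) * t = v * q.1 + w * s.1 - d := by rw [ht]; field_simp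
  have htq : t ≤ q.1 := by nlinarith
  have hts : t ≤ s.1 := by nlinarith
  have hzt' : z.1 ≤ t := by nlinarith
  obtain ⟨x, hx₁, hx₂⟩ := exists_norm_sub_le q.2 s.2 (a := v * (q.1 - t)) (b := w * (s.1 - t))
    (mul_nonneg hv.le (by linarith)) (mul_nonneg hw.le (by linarith)) (by linarith)
  refine ⟨(t, x), (mem_prism_iff hv).2 ⟨?_, ?_⟩, (mem_prism_iff hw).2 ⟨?_, ?_⟩, ?_⟩
  · rw [upGap, ← hpq]; simp only; nlinarith
  · rw [downGap]; simp only; linarith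
  · rw [upGap, hpr, ← hpq]; simp only; nlinarith
  · rw [downGap]; simp only; linarith
  · simp only; linarith

theorem firstContact_of_coaxial {p q r s z : ℝ × E} {v w : ℝ} (hv : 0 < v) (hw : 0 < w)
    (hpq : q.2 = p.2) (hps : s.2 = p.2) (hrim : w * |p.1 + q.1 - 2 * s.1| = v * (q.1 - p.1))
    (hp : p ∉ prism r s w) (hr : r ∉ prism p q v)
    (hz₁ : z ∈ rim p q v) (hz₂ : z ∈ prism r s w) : FirstContact p q v r s w := by
  refine LastContact.of_rev (lastContact_of_coaxial (z := rev z) hv hw hpq.symm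
    (hps.trans hpq.symm) ?_ ?_ ?_ ?_ (rev_mem_prism hz₂))
  · simp only [rev_fst]
    rw [← abs_neg, show -(-q.1 + -p.1 - 2 * -s.1) = p.1 + q.1 - 2 * s.1 by ring, hrim]; ring
  all_goals first | rwa [mem_prism_rev, rev_rev] | rwa [mem_rim_rev, rev_rev]

/-- If the origin of a bead lies on the line of a degenerate bead, at the same speed, then a common
point forces an apex to lie in the other bead. -/
theorem false_of_collinear {p q r s z : ℝ × E} {v c : ℝ} (hv : 0 < v)
    (hpq : ‖q.2 - p.2‖ = v * (q.1 - p.1)) (hrc : r = p + c • (q - p))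
    (hp : p ∉ prism r s v) (hr : r ∉ prism p q v)
    (hz₁ : z ∈ prism p q v) (hz₂ : z ∈ prism r s v) : False := by
  have hpqt : 0 ≤ q.1 - p.1 := by linarith [hz₁.2.2.1, hz₁.2.2.2]
  have hr1 : r.1 = p.1 + c * (q.1 - p.1) := by rw [hrc]; simp
  have hr2 : r.2 - p.2 = c • (q.2 - p.2) := by rw [hrc]; simp
  have hr3 : r.2 - q.2 = (c - 1) • (q.2 - p.2) := by
    rw [sub_smul, one_smul, ← hr2]; abel
  -- For `c < 0`, `p` lies on a ruling upward from `r`, hence in the second bead. For `0 ≤ c ≤ 1`,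
  -- `r` is on the segment from `p` to `q`. For `c > 1`, `r` is not earlier than `q`, so a common
  -- point forces `p.1 = q.1` and `r = p`.
  rcases lt_or_ge c 0 with hc | hc
  · refine hp ((mem_prism_iff hv).2 ⟨?_, ?_⟩)
    · rw [upGap, norm_sub_rev, hr2, norm_smul, Real.norm_of_nonpos hc.le, hpq, hr1]
      exact le_of_eq (by ring)
    · have h₁ := hz₁.1
      have h₂ := hz₂.2.1
      have := norm_sub_le (z.2 - s.2) (z.2 - p.2)
      rw [show z.2 - s.2 - (z.2 - p.2) = p.2 - s.2 by abel] at this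
      unfold upGap at h₁
      unfold downGap at h₂ ⊢
      linarith
  rcases le_or_gt c 1 with hc1 | hc1
  · refine hr ((mem_prism_iff hv).2 ⟨?_, ?_⟩)
    · rw [upGap, hr2, norm_smul, Real.norm_of_nonneg hc, hpq, hr1]
      exact le_of_eq (by ring)
    · rw [downGap, hr3, norm_smul, Real.norm_of_nonpos (by linarith), hpq, hr1]
      exact le_of_eq (by ring)
  · have h₁ := hz₁.2.2.2
    have h₂ := hz₂.2.2.1
    have hrq : q.1 ≤ r.1 := by rw [hr1]; nlinarith
    have h0 : (c - 1) * (q.1 - p.1) = 0 := by nlinarith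
    have h0' := (mul_eq_zero.1 h0).resolve_left (by linarith)
    have hn : q.2 - p.2 = 0 := by rw [← norm_eq_zero, hpq, h0', mul_zero]
    rw [hn, smul_zero] at hr2
    have : r = p := Prod.ext (by rw [hr1, h0', mul_zero, add_zero]) (sub_eq_zero.1 hr2)
    exact hr (by rw [this]; exact left_mem_prism hz₁)

end Geometry

/-! ### Evaluation of terms and the roots of quartics -/

section Semantics

variable {n : ℕ}

namespace Tm

variable (env : Fin n → ℝ)

@[simp] theorem eval_add (s t : Tm n) : (s + t).eval env = s.eval env + t.eval env := rfl
@[simp] theorem eval_sub (s t : Tm n) : (s - t).eval env = s.eval env - t.eval env := rfl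
@[simp] theorem eval_neg (s : Tm n) : (-s).eval env = -s.eval env := rfl
@[simp] theorem eval_mul (s t : Tm n) : (s * t).eval env = s.eval env * t.eval env := rfl
@[simp] theorem eval_pow (s : Tm n) (k : ℕ) : (s ^ k).eval env = s.eval env ^ k := rfl
@[simp] theorem eval_sqrt (s : Tm n) : (Tm.sqrt s).eval env = √(s.eval env) := rfl
@[simp] theorem eval_var (i : Fin n) : (Tm.var i).eval env = env i := rfl
@[simp] theorem eval_zero : (0 : Tm n).eval env = 0 := Nat.cast_zero
@[simp] theorem eval_two : (2 : Tm n).eval env = 2 := Nat.cast_ofNat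
@[simp] theorem eval_four : (4 : Tm n).eval env = 4 := Nat.cast_ofNat

@[simp] theorem eval_lift (t : Tm n) (x : ℝ) :
    t.lift.eval (Fin.snoc (α := fun _ => ℝ) env x) = t.eval env := by
  induction t <;> simp_all [lift, eval]

end Tm

@[simp] theorem Pt.lift_t (p : Pt n) : p.lift.t = p.t.lift := rfl
@[simp] theorem Pt.lift_x (p : Pt n) : p.lift.x = p.x.lift := rfl
@[simp] theorem Pt.lift_y (p : Pt n) : p.lift.y = p.y.lift := rfl

end Semantics

/-- The zero polynomial has an empty multiset of roots, whence the first conjunct. It is the reason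
why exceptional positions need a separate argument. -/
theorem mem_quarticRoots {a b c d e x : ℝ} :
    x ∈ quarticRoots a b c d e ↔ ¬ (a = 0 ∧ b = 0 ∧ c = 0 ∧ d = 0 ∧ e = 0) ∧
      a * x ^ 4 + b * x ^ 3 + c * x ^ 2 + d * x + e = 0 := by
  have hne : (Polynomial.C a * Polynomial.X ^ 4 + Polynomial.C b * Polynomial.X ^ 3 +
      Polynomial.C c * Polynomial.X ^ 2 + Polynomial.C d * Polynomial.X +
      Polynomial.C e) = 0 ↔ a = 0 ∧ b = 0 ∧ c = 0 ∧ d = 0 ∧ e = 0 := by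
    constructor
    · intro h
      have hc := fun k => congrArg (fun f => Polynomial.coeff f k) h
      have h0 := hc 0
      have h1 := hc 1
      have h2 := hc 2
      have h3 := hc 3
      have h4 := hc 4
      simp [Polynomial.coeff_X, Polynomial.coeff_C, Polynomial.coeff_X_pow] at h0 h1 h2 h3 h4
      exact ⟨h4, h3, h2, h1, h0⟩
    · rintro ⟨rfl, rfl, rfl, rfl, rfl⟩
      simp
  rw [quarticRoots, Multiset.mem_toFinset, Polynomial.mem_roots', ne_eq, hne, Polynomial.IsRoot]
  simp

/-! ## Points with respect to a bead with the apexes `(0, 0, 0)` and `(tq, xq, 0)` -/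

section Local

variable {tq xq v tr xr yr ts xs ys w t x y : ℝ}

/-- The quartic is `N² - M (-4 K x² + 4 xq K x + K²)`. -/
theorem quartic_eq (A B C M K : ℝ) :
    A ^ 2 * x ^ 4 + 2 * A * B * x ^ 3 + (B ^ 2 + 2 * A * C + 4 * M * K) * x ^ 2 +
      (2 * B * C - 4 * M * xq * K) * x + (C ^ 2 - M * K ^ 2) =
    (A * x ^ 2 + B * x + C) ^ 2 - M * (-(4 * K * x ^ 2) + 4 * xq * K * x + K ^ 2) := by
  ring

/-- If the quartic vanishes identically, so do its constituents. -/
theorem quartic_coeffs {A B C M K : ℝ} (hK : 0 ≤ K) (hM : 0 ≤ M)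
    (h : A ^ 2 = 0 ∧ 2 * A * B = 0 ∧ B ^ 2 + 2 * A * C + 4 * M * K = 0 ∧
      2 * B * C - 4 * M * xq * K = 0 ∧ C ^ 2 - M * K ^ 2 = 0) :
    A = 0 ∧ B = 0 ∧ C = 0 ∧ M * K = 0 := by
  obtain ⟨h₁, -, h₃, -, h₅⟩ := h
  have hA : A = 0 := by simpa using h₁
  have hMK : 0 ≤ M * K := mul_nonneg hM hK
  -- Once `A = 0`, the coefficient of `x ^ 2` is a sum of the non-negative terms `B ^ 2` and `4 * M
  -- * K`.
  have hMK0 : M * K = 0 := by rw [hA] at h₃; nlinarith [sq_nonneg B]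
  have hB : B ^ 2 = 0 := by rw [hA] at h₃; nlinarith
  have hC : C ^ 2 = 0 := by
    have : M * K ^ 2 = M * K * K := by ring
    rw [this, hMK0] at h₅; linarith
  exact ⟨hA, by simpa using hB, by simpa using hC, hMK0⟩

/-- The rim points satisfy `D t = T` and `D² y² = S`. -/
theorem rim_iff (hv : 0 < v) (ht : 0 < tq) :
    (x ^ 2 + y ^ 2 = (v * t) ^ 2 ∧ (x - xq) ^ 2 + y ^ 2 = (v * (tq - t)) ^ 2) ↔
      (2 * v ^ 2 * tq * t = 2 * x * xq - xq ^ 2 + v ^ 2 * tq ^ 2 ∧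
        (2 * v ^ 2 * tq) ^ 2 * y ^ 2 =
          v ^ 2 * (2 * x * xq - xq ^ 2 + v ^ 2 * tq ^ 2) ^ 2 - (2 * v ^ 2 * tq) ^ 2 * x ^ 2) := by
  constructor
  · rintro ⟨h₁, h₂⟩
    have h : 2 * v ^ 2 * tq * t = 2 * x * xq - xq ^ 2 + v ^ 2 * tq ^ 2 := by
      linear_combination h₂ - h₁
    refine ⟨h, ?_⟩
    rw [← h]
    linear_combination (2 * v ^ 2 * tq) ^ 2 * h₁
  · rintro ⟨h₁, h₂⟩
    have hD : (2 * v ^ 2 * tq) ^ 2 ≠ 0 := by positivity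
    have h : x ^ 2 + y ^ 2 = (v * t) ^ 2 := by
      apply mul_left_cancel₀ hD
      rw [← h₁] at h₂
      linear_combination h₂
    exact ⟨h, by linear_combination h + h₁⟩

/-- A rim point lies on the double cone with apex `r` if and only if `-2 yr D² y = N`. -/
theorem cone_iff (hv : 0 < v) (ht : 0 < tq)
    (h₁ : 2 * v ^ 2 * tq * t = 2 * x * xq - xq ^ 2 + v ^ 2 * tq ^ 2)
    (h₂ : (2 * v ^ 2 * tq) ^ 2 * y ^ 2 =
          v ^ 2 * (2 * x * xq - xq ^ 2 + v ^ 2 * tq ^ 2) ^ 2 - (2 * v ^ 2 * tq) ^ 2 * x ^ 2) :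
    (x - xr) ^ 2 + (y - yr) ^ 2 = (w * (t - tr)) ^ 2 ↔
      -2 * yr * (2 * v ^ 2 * tq) ^ 2 * y =
        (2 * x * xq - xq ^ 2 + v ^ 2 * tq ^ 2 - 2 * v ^ 2 * tq * tr) ^ 2 * w ^ 2
          - (2 * v ^ 2 * tq) ^ 2 * (x - xr) ^ 2 - (2 * v ^ 2 * tq) ^ 2 * yr ^ 2
          - (v ^ 2 * (2 * x * xq - xq ^ 2 + v ^ 2 * tq ^ 2) ^ 2
            - (2 * v ^ 2 * tq) ^ 2 * x ^ 2) := by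
  have hD : (2 * v ^ 2 * tq) ^ 2 ≠ 0 := by positivity
  rw [← mul_right_inj' hD, ← h₂, ← h₁]
  constructor <;> intro h <;> linear_combination h

/-- The half-space condition, after multiplication by a positive number. -/
theorem half_iff {D Z T Y : ℝ} (hD : 0 < D) (hZ : 0 < Z) (hT : D * t = T) (hY : Z * y = Y)
    (h : (x - xr) ^ 2 + (y - yr) ^ 2 = (w * (t - tr)) ^ 2) :
    D * (Z * (2 * x * (xr - xs) + xs ^ 2 - xr ^ 2 + ys ^ 2 - yr ^ 2) + 2 * Y * (yr - ys)) ≤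
        Z * w ^ 2 * (2 * T * (tr - ts) + D * (ts ^ 2 - tr ^ 2)) ↔
      (x - xs) ^ 2 + (y - ys) ^ 2 ≤ (w * (t - ts)) ^ 2 := by
  subst hT hY
  -- The equation of the cone at `r` supplies the squares that are absent from the affine
  -- inequality.
  have e₁ : D * (Z * (2 * x * (xr - xs) + xs ^ 2 - xr ^ 2 + ys ^ 2 - yr ^ 2) +
      2 * (Z * y) * (yr - ys)) = D * Z * ((x - xs) ^ 2 + (y - ys) ^ 2 - (w * (t - tr)) ^ 2) := by
    rw [← h]; ring
  have e₂ : Z * w ^ 2 * (2 * (D * t) * (tr - ts) + D * (ts ^ 2 - tr ^ 2)) =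
      D * Z * ((w * (t - ts)) ^ 2 - (w * (t - tr)) ^ 2) := by ring
  rw [e₁, e₂, mul_le_mul_iff_right₀ (mul_pos hD hZ), sub_le_sub_iff_right]

end Local

/-- The point `z` of the rim of the first bead lies on the double cone with apex `r`, inside the
double cone with apex `s`, and between `r` and `s` in time. -/
def RimPoint (p q : ℝ × ℂ) (v : ℝ) (r s : ℝ × ℂ) (w : ℝ) (z : ℝ × ℂ) : Prop :=
  z ∈ rim p q v ∧ ‖z.2 - r.2‖ ^ 2 = (w * (z.1 - r.1)) ^ 2 ∧
    ‖z.2 - s.2‖ ^ 2 ≤ (w * (z.1 - s.1)) ^ 2 ∧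
    (r.1 ≤ z.1 ∧ z.1 ≤ s.1 ∨ s.1 ≤ z.1 ∧ z.1 ≤ r.1)

/-- The exceptional positions of the apex `r` relative to a bead, for which the double cone with
apex `r` contains the rim. -/
def Exceptional (p q : ℝ × ℂ) (v : ℝ) (r : ℝ × ℂ) (w : ℝ) : Prop :=
  r = p ∨ r = q ∨ (‖q.2 - p.2‖ = v * (q.1 - p.1) ∧ w = v ∧ ∃ c : ℝ, r = p + c • (q - p)) ∨
    (q.2 = p.2 ∧ r.2 = p.2 ∧ w * |p.1 + q.1 - 2 * r.1| = v * (q.1 - p.1))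

theorem norm_sub_sq_coord (a b : ℂ) : ‖a - b‖ ^ 2 = (a.re - b.re) ^ 2 + (a.im - b.im) ^ 2 := by
  rw [Complex.sq_norm, Complex.normSq_apply, Complex.sub_re, Complex.sub_im]; ring

/-! ### Rim points as roots of the quartic -/

section Formula

variable {n : ℕ} {env : Fin n → ℝ}

/-- The value of a point. -/
noncomputable def Pt.val (p : Pt n) (env : Fin n → ℝ) : ℝ × ℂ :=
  (p.t.eval env, ⟨p.x.eval env, p.y.eval env⟩)

/-- Squaring the cone equations loses the signs of `z.1` and `q.1 - z.1`; the time bounds restore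
them. -/
theorem mem_rim_local_iff {q z : ℝ × ℂ} {v : ℝ} (hv : 0 < v) (hq : q.2.im = 0) :
    z ∈ rim 0 q v ↔ (z.2.re ^ 2 + z.2.im ^ 2 = (v * z.1) ^ 2 ∧
      (z.2.re - q.2.re) ^ 2 + z.2.im ^ 2 = (v * (q.1 - z.1)) ^ 2) ∧ 0 ≤ z.1 ∧ z.1 ≤ q.1 := by
  have e₁ : z.2.re ^ 2 + z.2.im ^ 2 = ‖z.2‖ ^ 2 := by
    rw [Complex.sq_norm, Complex.normSq_apply]; ring
  have e₂ : (z.2.re - q.2.re) ^ 2 + z.2.im ^ 2 = ‖z.2 - q.2‖ ^ 2 := by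
    rw [norm_sub_sq_coord, hq, sub_zero]
  rw [e₁, e₂]
  constructor
  · intro h
    have h₁ := fst_le_of_upGap hv h.1.le
    have h₂ := fst_le_of_downGap hv h.2.le
    obtain ⟨g₁, g₂⟩ := h
    simp only [upGap, downGap, Prod.fst_zero, Prod.snd_zero, sub_zero] at g₁ g₂ h₁
    rw [sub_eq_zero.1 g₁, sub_eq_zero.1 g₂]
    exact ⟨⟨rfl, rfl⟩, h₁, h₂⟩
  · rintro ⟨⟨h₁, h₂⟩, h₃, h₄⟩
    refine ⟨?_, ?_⟩
    · simp only [upGap, Prod.fst_zero, Prod.snd_zero, sub_zero]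
      exact sub_eq_zero.2 ((pow_left_inj₀ (norm_nonneg _) (mul_nonneg hv.le h₃) two_ne_zero).1 h₁)
    · exact sub_eq_zero.2 ((pow_left_inj₀ (norm_nonneg _)
        (mul_nonneg hv.le (sub_nonneg.2 h₄)) two_ne_zero).1 h₂)

theorem rimPoint_local_iff {tq xq v tr xr yr ts xs ys w t x y D T S N : ℝ} (hv : 0 < v)
    (ht : 0 < tq) (hD : D = 2 * v ^ 2 * tq) (hT : T = 2 * x * xq - xq ^ 2 + v ^ 2 * tq ^ 2)
    (hS : S = v ^ 2 * T ^ 2 - D ^ 2 * x ^ 2)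
    (hN : N = (T - D * tr) ^ 2 * w ^ 2 - D ^ 2 * (x - xr) ^ 2 - D ^ 2 * yr ^ 2 - S) :
    RimPoint 0 (tq, ⟨xq, 0⟩) v (tr, ⟨xr, yr⟩) (ts, ⟨xs, ys⟩) w (t, ⟨x, y⟩) ↔
      ((D * t = T ∧ D ^ 2 * y ^ 2 = S) ∧ 0 ≤ t ∧ t ≤ tq) ∧ -2 * yr * D ^ 2 * y = N ∧
        (x - xs) ^ 2 + (y - ys) ^ 2 ≤ (w * (t - ts)) ^ 2 ∧
        (tr ≤ t ∧ t ≤ ts ∨ ts ≤ t ∧ t ≤ tr) := by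
  unfold RimPoint
  rw [mem_rim_local_iff hv rfl, norm_sub_sq_coord, norm_sub_sq_coord]
  subst hN hS hT hD
  simp only
  rw [rim_iff hv ht]
  constructor
  · rintro ⟨⟨⟨h₁, h₂⟩, h₃⟩, h₄, h₅⟩
    exact ⟨⟨⟨h₁, h₂⟩, h₃⟩, (cone_iff hv ht h₁ h₂).1 h₄, h₅⟩
  · rintro ⟨⟨⟨h₁, h₂⟩, h₃⟩, h₄, h₅⟩
    exact ⟨⟨⟨h₁, h₂⟩, h₃⟩, (cone_iff hv ht h₁ h₂).2 h₄, h₅⟩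

/-- There is a suitable rim point with the coordinate `x` if and only if `x` satisfies the quartic
equation and the side conditions. -/
theorem exists_rimPoint_iff {tq xq v tr xr yr ts xs ys w x D T S N K A B C M : ℝ} (hv : 0 < v)
    (ht : 0 < tq) (hD : D = 2 * v ^ 2 * tq) (hT : T = 2 * x * xq - xq ^ 2 + v ^ 2 * tq ^ 2)
    (hS : S = v ^ 2 * T ^ 2 - D ^ 2 * x ^ 2)
    (hN : N = (T - D * tr) ^ 2 * w ^ 2 - D ^ 2 * (x - xr) ^ 2 - D ^ 2 * yr ^ 2 - S)
    (hK : K = v ^ 2 * tq ^ 2 - xq ^ 2) (hA : A = 4 * xq ^ 2 * (w ^ 2 - v ^ 2))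
    (hB : B = 4 * (xq * w ^ 2 * (K - D * tr) + 2 * v ^ 4 * tq ^ 2 * xr - v ^ 2 * xq * K))
    (hC : C = w ^ 2 * (K - D * tr) ^ 2 - 4 * v ^ 4 * tq ^ 2 * (xr ^ 2 + yr ^ 2) - v ^ 2 * K ^ 2)
    (hM : M = (2 * v * yr * D) ^ 2) :
    (∃ t y, RimPoint 0 (tq, ⟨xq, 0⟩) v (tr, ⟨xr, yr⟩) (ts, ⟨xs, ys⟩) w (t, ⟨x, y⟩)) ↔
      A ^ 2 * x ^ 4 + 2 * A * B * x ^ 3 + (B ^ 2 + 2 * A * C + 4 * M * K) * x ^ 2 +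
        (2 * B * C - 4 * M * xq * K) * x + (C ^ 2 - M * K ^ 2) = 0 ∧
      0 ≤ -(4 * K * x ^ 2) + 4 * xq * K * x + K ^ 2 ∧
      (yr = 0 ∧
        (D * (D * (2 * x * (xr - xs) + xs ^ 2 - xr ^ 2 + ys ^ 2 - yr ^ 2) + 2 * √S * (yr - ys)) ≤
          D * w ^ 2 * (2 * T * (tr - ts) + D * (ts ^ 2 - tr ^ 2)) ∨
        D * (D * (2 * x * (xr - xs) + xs ^ 2 - xr ^ 2 + ys ^ 2 - yr ^ 2) + 2 * -√S * (yr - ys)) ≤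
          D * w ^ 2 * (2 * T * (tr - ts) + D * (ts ^ 2 - tr ^ 2))) ∨
       ¬ yr = 0 ∧
        D * (2 * yr ^ 2 * D ^ 2 * (2 * x * (xr - xs) + xs ^ 2 - xr ^ 2 + ys ^ 2 - yr ^ 2) +
            2 * -(yr * N) * (yr - ys)) ≤
          2 * yr ^ 2 * D ^ 2 * w ^ 2 * (2 * T * (tr - ts) + D * (ts ^ 2 - tr ^ 2))) ∧
      0 ≤ tq * T ∧ tq * T ≤ 2 * v ^ 2 * tq ^ 3 ∧
      (tr * (2 * v ^ 2 * tq ^ 2) ≤ tq * T ∧ tq * T ≤ ts * (2 * v ^ 2 * tq ^ 2) ∨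
        ts * (2 * v ^ 2 * tq ^ 2) ≤ tq * T ∧ tq * T ≤ tr * (2 * v ^ 2 * tq ^ 2)) := by
  have hD0 : 0 < D := by rw [hD]; positivity
  have hc : 0 < 2 * v ^ 2 * tq ^ 2 := by positivity
  have hSP : S = v ^ 2 * (-(4 * K * x ^ 2) + 4 * xq * K * x + K ^ 2) := by
    rw [hS, hT, hD, hK]; ring
  have hNP : N = A * x ^ 2 + B * x + C := by
    rw [hN, hA, hB, hC, hS, hT, hD, hK]; ring
  have hMP : M * (-(4 * K * x ^ 2) + 4 * xq * K * x + K ^ 2) = 4 * yr ^ 2 * D ^ 2 * S := by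
    rw [hM, hSP]; ring
  rw [quartic_eq, ← hNP, hMP]
  have htime : ∀ t, D * t = T → (0 ≤ tq * T ↔ 0 ≤ t) ∧ (tq * T ≤ 2 * v ^ 2 * tq ^ 3 ↔ t ≤ tq) ∧
      ∀ u, (u * (2 * v ^ 2 * tq ^ 2) ≤ tq * T ↔ u ≤ t) ∧
        (tq * T ≤ u * (2 * v ^ 2 * tq ^ 2) ↔ t ≤ u) := by
    intro t h
    have e : tq * T = t * (2 * v ^ 2 * tq ^ 2) := by rw [← h, hD]; ring
    rw [e, show 2 * v ^ 2 * tq ^ 3 = tq * (2 * v ^ 2 * tq ^ 2) by ring]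
    exact ⟨mul_nonneg_iff_of_pos_right hc, mul_le_mul_iff_left₀ hc,
      fun u => ⟨mul_le_mul_iff_left₀ hc, mul_le_mul_iff_left₀ hc⟩⟩
  have hcone : ∀ t y, D * t = T → D ^ 2 * y ^ 2 = S → -2 * yr * D ^ 2 * y = N →
      (x - xr) ^ 2 + (y - yr) ^ 2 = (w * (t - tr)) ^ 2 := by
    intro t y h₁ h₂ h₃
    subst hN hS hT hD
    exact (cone_iff hv ht h₁ h₂).2 h₃
  simp only [rimPoint_local_iff hv ht hD hT hS hN]
  constructor
  · rintro ⟨t, y, ⟨⟨h₁, h₂⟩, h₃, h₄⟩, h₅, h₆, h₇⟩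
    obtain ⟨i₁, i₂, i₃⟩ := htime t h₁
    have hr := hcone t y h₁ h₂ h₅
    have hS0 : 0 ≤ S := by rw [← h₂]; positivity
    rw [i₁, i₂, (i₃ tr).1, (i₃ tr).2, (i₃ ts).1, (i₃ ts).2]
    refine ⟨?_, ?_, ?_, h₃, h₄, h₇⟩
    · rw [← h₅, ← h₂]; ring
    · rw [hSP] at hS0
      exact nonneg_of_mul_nonneg_right hS0 (by positivity)
    · by_cases hy : yr = 0
      · refine .inl ⟨hy, ?_⟩
        have hsq : √S = |D * y| := by rw [← h₂, ← mul_pow, Real.sqrt_sq_eq_abs]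
        rcases abs_choice (D * y) with h | h
        · exact .inl ((half_iff hD0 hD0 h₁ (by rw [hsq, h]) hr).2 h₆)
        · exact .inr ((half_iff hD0 hD0 h₁ (by rw [hsq, h, neg_neg]) hr).2 h₆)
      · refine .inr ⟨hy, (half_iff hD0 (by positivity) h₁ ?_ hr).2 h₆⟩
        rw [← h₅]; ring
  · rintro ⟨h₁, h₂, h₃, h₄, h₅, h₆⟩
    have hDt : D * (T / D) = T := by field_simp
    obtain ⟨i₁, i₂, i₃⟩ := htime _ hDt
    rw [i₁] at h₄
    rw [i₂] at h₅
    rw [(i₃ tr).1, (i₃ tr).2, (i₃ ts).1, (i₃ ts).2] at h₆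
    have hS0 : 0 ≤ S := by rw [hSP]; positivity
    suffices h : ∃ y, D ^ 2 * y ^ 2 = S ∧ -2 * yr * D ^ 2 * y = N ∧
        (x - xs) ^ 2 + (y - ys) ^ 2 ≤ (w * (T / D - ts)) ^ 2 by
      obtain ⟨y, g₁, g₂, g₃⟩ := h
      exact ⟨T / D, y, ⟨⟨hDt, g₁⟩, h₄, h₅⟩, g₂, g₃, h₆⟩
    rcases h₃ with ⟨hy, h₃⟩ | ⟨hy, h₃⟩
    -- For `yr = 0` the quartic says `N = 0`, and the cone equation holds for both signs of `y`;
    -- `h₃` selects one.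
    · have hN0 : N = 0 := by simpa [hy] using h₁
      have key : ∀ Y : ℝ, Y ^ 2 = S → D ^ 2 * (Y / D) ^ 2 = S ∧ D * (Y / D) = Y := by
        intro Y hY
        rw [← hY]
        constructor <;> field_simp
      rcases h₃ with h₃ | h₃
      · obtain ⟨k₁, k₂⟩ := key _ (Real.sq_sqrt hS0)
        have hN' : -2 * yr * D ^ 2 * (√S / D) = N := by rw [hN0, hy]; ring
        exact ⟨_, k₁, hN', (half_iff hD0 hD0 hDt k₂ (hcone _ _ hDt k₁ hN')).1 h₃⟩
      · obtain ⟨k₁, k₂⟩ := key (-√S) (by rw [neg_sq, Real.sq_sqrt hS0])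
        have hN' : -2 * yr * D ^ 2 * (-√S / D) = N := by rw [hN0, hy]; ring
        exact ⟨_, k₁, hN', (half_iff hD0 hD0 hDt k₂ (hcone _ _ hDt k₁ hN')).1 h₃⟩
    -- For `yr ≠ 0` the cone equation determines `y`, and the quartic then says exactly that this
    -- `y` satisfies `D ^ 2 * y ^ 2 = S`. Squaring has added no spurious root.
    · have hN' : -2 * yr * D ^ 2 * (-N / (2 * yr * D ^ 2)) = N := by field_simp
      have hk : D ^ 2 * (-N / (2 * yr * D ^ 2)) ^ 2 = S := by
        have : N ^ 2 = 4 * yr ^ 2 * D ^ 2 * S := by linarith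
        rw [div_pow, neg_sq, this]; field_simp; ring
      refine ⟨_, hk, hN', (half_iff hD0 (by positivity) hDt ?_ (hcone _ _ hDt hk hN')).1 h₃⟩
      field_simp

theorem exists_rimPoint_of_holds {q r s : Pt n} {v w : Tm n} (hv : 0 < v.eval env)
    (ht : 0 < q.t.eval env) (hq : q.y.eval env = 0) (h : (phiRhoMantel q v r s w).Holds env) :
    ∃ z, RimPoint 0 (q.val env) (v.eval env) (r.val env) (s.val env) (w.eval env) z := by
  simp only [phiRhoMantel, phiRoots, phiSqrt, psiRhoMantel, psiHalf, tmS, tmT, tmD, tmN, tmK, cfA,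
    cfB, cfC, cfM, Fm.Holds, mem_quarticRoots, Tm.eval_add, Tm.eval_sub, Tm.eval_neg, Tm.eval_mul,
    Tm.eval_pow, Tm.eval_sqrt, Tm.eval_zero, Tm.eval_two, Tm.eval_four, Tm.eval_var, Tm.eval_lift,
    Pt.lift_t, Pt.lift_x, Pt.lift_y, Fin.snoc_last] at h
  obtain ⟨x, ⟨-, h₁⟩, h₂⟩ := h
  obtain ⟨t, y, h⟩ := (exists_rimPoint_iff (xq := q.x.eval env) (tr := r.t.eval env)
    (xr := r.x.eval env) (yr := r.y.eval env) (ts := s.t.eval env) (xs := s.x.eval env)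
    (ys := s.y.eval env) (w := w.eval env) (x := x) hv ht rfl rfl rfl rfl rfl rfl rfl rfl rfl).2
    ⟨h₁, h₂⟩
  refine ⟨(t, ⟨x, y⟩), ?_⟩
  unfold Pt.val
  rw [hq]
  exact h

/-- If the quartic vanishes identically, the apex is in an exceptional position. -/
theorem exceptional_of_coeffs {tq xq v tr xr yr w D K A B C M : ℝ} (hv : 0 < v) (hw : 0 < w)
    (ht : 0 < tq) (hD : D = 2 * v ^ 2 * tq) (hK : K = v ^ 2 * tq ^ 2 - xq ^ 2) (hK0 : 0 ≤ K)
    (hA : A = 4 * xq ^ 2 * (w ^ 2 - v ^ 2))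
    (hB : B = 4 * (xq * w ^ 2 * (K - D * tr) + 2 * v ^ 4 * tq ^ 2 * xr - v ^ 2 * xq * K))
    (hC : C = w ^ 2 * (K - D * tr) ^ 2 - 4 * v ^ 4 * tq ^ 2 * (xr ^ 2 + yr ^ 2) - v ^ 2 * K ^ 2)
    (hM : M = (2 * v * yr * D) ^ 2)
    (h : A ^ 2 = 0 ∧ 2 * A * B = 0 ∧ B ^ 2 + 2 * A * C + 4 * M * K = 0 ∧
      2 * B * C - 4 * M * xq * K = 0 ∧ C ^ 2 - M * K ^ 2 = 0) :
    Exceptional 0 (tq, ⟨xq, 0⟩) v (tr, ⟨xr, yr⟩) w := by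
  obtain ⟨hA0, hB0, hC0, hMK⟩ := quartic_coeffs hK0 (by rw [hM]; positivity) h
  have hD0 : 0 < D := by rw [hD]; positivity
  have hyK : yr = 0 ∨ K = 0 := by
    rcases mul_eq_zero.1 hMK with h | h
    · rw [hM] at h
      have : 2 * v * yr * D = 0 := by simpa using h
      exact .inl (by simpa [hv.ne', hD0.ne'] using this)
    · exact .inr h
  have hA' : xq = 0 ∨ w = v := by
    rw [hA] at hA0
    rcases mul_eq_zero.1 hA0 with h | h
    · left; simpa using h
    · exact .inr ((pow_left_inj₀ hw.le hv.le two_ne_zero).1 (sub_eq_zero.1 h))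
  -- For `w = v`, `B = 0` gives `tq * xr = xq * tr`, and `C = 0` leaves a degenerate bead (`K = 0`)
  -- or an apex. For `w ≠ v`, `xq = 0` makes `K` positive, and only the coaxial position remains.
  by_cases hwv : w = v
  · rw [hwv] at hB hC
    have hx : tq * xr = xq * tr := by
      have : 8 * v ^ 4 * tq * (tq * xr - xq * tr) = 0 := by
        rw [hB, hD] at hB0; linear_combination hB0
      have h8 : 8 * v ^ 4 * tq ≠ 0 := by positivity
      exact sub_eq_zero.1 ((mul_eq_zero.1 this).resolve_left h8)
    have hxr : xr = tr / tq * xq := by field_simp; linarith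
    have hC' : 4 * v ^ 4 * (K * tr * (tr - tq) - tq ^ 2 * yr ^ 2) = 0 := by
      have hx2 : tq ^ 2 * xr ^ 2 = xq ^ 2 * tr ^ 2 := by rw [← mul_pow, hx, mul_pow]
      rw [hC, hD] at hC0
      rw [hK] at hC0 ⊢
      linear_combination hC0 + 4 * v ^ 4 * hx2
    have hC'' : K * tr * (tr - tq) - tq ^ 2 * yr ^ 2 = 0 := by
      have h4 : 4 * v ^ 4 ≠ 0 := by positivity
      exact (mul_eq_zero.1 hC').resolve_left h4
    by_cases hK' : K = 0
    · have hy : yr = 0 := by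
        rw [hK'] at hC''
        have : tq ^ 2 * yr ^ 2 = 0 := by linarith
        simpa [ht.ne'] using this
      refine .inr (.inr (.inl ⟨?_, hwv, tr / tq, ?_⟩))
      · have h₁ : ‖(⟨xq, 0⟩ : ℂ)‖ ^ 2 = (v * tq) ^ 2 := by
          rw [Complex.sq_norm, Complex.normSq_apply]
          simp only
          rw [hK] at hK'; linarith
        simp only [Prod.snd_zero, Prod.fst_zero, sub_zero]
        exact (pow_left_inj₀ (norm_nonneg _) (by positivity) two_ne_zero).1 h₁
      · rw [sub_zero, zero_add]
        refine Prod.ext ?_ (Complex.ext ?_ ?_)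
        · simp [ht.ne']
        · simpa using hxr
        · simpa using hy
    · have hy : yr = 0 := hyK.resolve_right hK'
      rw [hy] at hC''
      have : tr * (tr - tq) = 0 := by
        have : K * (tr * (tr - tq)) = 0 := by linarith
        exact (mul_eq_zero.1 this).resolve_left hK'
      rcases mul_eq_zero.1 this with h | h
      · refine .inl ?_
        rw [h] at hxr
        rw [h, hxr, hy, zero_div, zero_mul]
        rfl
      · refine .inr (.inl ?_)
        rw [sub_eq_zero.1 h, div_self ht.ne', one_mul] at hxr
        rw [sub_eq_zero.1 h, hxr, hy]
  · have hxq : xq = 0 := hA'.resolve_right hwv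
    have hKe : K = v ^ 2 * tq ^ 2 := by rw [hK, hxq]; ring
    have hKp : K ≠ 0 := by rw [hKe]; positivity
    have hy : yr = 0 := hyK.resolve_right hKp
    have hx : xr = 0 := by
      rw [hB, hxq] at hB0
      have : 8 * v ^ 4 * tq ^ 2 * xr = 0 := by linarith
      have h8 : 8 * v ^ 4 * tq ^ 2 ≠ 0 := by positivity
      exact (mul_eq_zero.1 this).resolve_left h8
    refine .inr (.inr (.inr ⟨?_, ?_, ?_⟩))
    · rw [hxq]; rfl
    · rw [hx, hy]; rfl
    · simp only [Prod.fst_zero, zero_add, sub_zero]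
      refine (pow_left_inj₀ (by positivity) (by positivity) two_ne_zero).1 ?_
      rw [mul_pow, sq_abs]
      have h4 : v ^ 4 * tq ^ 2 ≠ 0 := by positivity
      apply mul_left_cancel₀ h4
      rw [hC, hKe, hD, hx, hy] at hC0
      linear_combination hC0

/-- The `x`-coordinate of a rim point always satisfies the quartic equation. It is missing from the
listed roots only if all coefficients vanish. -/
theorem exceptional_or_holds {q r s : Pt n} {v w : Tm n} {z : ℝ × ℂ} (hv : 0 < v.eval env)
    (hw : 0 < w.eval env) (ht : 0 < q.t.eval env) (hq : q.y.eval env = 0)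
    (h : RimPoint 0 (q.val env) (v.eval env) (r.val env) (s.val env) (w.eval env) z) :
    Exceptional 0 (q.val env) (v.eval env) (r.val env) (w.eval env) ∨
      (phiRhoMantel q v r s w).Holds env := by
  simp only [phiRhoMantel, phiRoots, phiSqrt, psiRhoMantel, psiHalf, tmS, tmT, tmD, tmN, tmK, cfA,
    cfB, cfC, cfM, Fm.Holds, mem_quarticRoots, Tm.eval_add, Tm.eval_sub, Tm.eval_neg, Tm.eval_mul,
    Tm.eval_pow, Tm.eval_sqrt, Tm.eval_zero, Tm.eval_two, Tm.eval_four, Tm.eval_var, Tm.eval_lift,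
    Pt.lift_t, Pt.lift_x, Pt.lift_y, Fin.snoc_last]
  have hK := norm_sub_le_of_prism h.1.1.le h.1.2.le
  unfold Pt.val at *
  rw [hq] at h hK ⊢
  have hK0 : 0 ≤ v.eval env ^ 2 * q.t.eval env ^ 2 - q.x.eval env ^ 2 := by
    have := pow_le_pow_left₀ (norm_nonneg _) hK 2
    rw [norm_sub_sq_coord] at this
    simp only [Prod.fst_zero, Prod.snd_zero, Complex.zero_re, Complex.zero_im, sub_zero] at this
    linarith
  rw [or_iff_not_imp_left]
  intro hne
  obtain ⟨h₁, h₂⟩ := (exists_rimPoint_iff hv ht rfl rfl rfl rfl rfl rfl rfl rfl rfl).1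
    ⟨z.1, z.2.im, h⟩
  exact ⟨z.2.re, ⟨fun h0 => hne (exceptional_of_coeffs hv hw ht rfl rfl hK0 rfl rfl rfl rfl h0), h₁⟩,
    h₂⟩

/-! ## Change of coordinates -/

/-- The translation of `p` to the origin, followed by a rotation and a scaling. -/
noncomputable def move (p : ℝ × ℂ) (u : ℂ) (z : ℝ × ℂ) : ℝ × ℂ :=
  (‖u‖ * (z.1 - p.1), u * (z.2 - p.2))

theorem move_self (p : ℝ × ℂ) (u : ℂ) : move p u p = 0 := by simp [move]

theorem move_surjective (p : ℝ × ℂ) {u : ℂ} (hu : u ≠ 0) : Function.Surjective (move p u) := by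
  intro z
  have hu' : ‖u‖ ≠ 0 := norm_ne_zero_iff.2 hu
  refine ⟨(p.1 + z.1 / ‖u‖, p.2 + z.2 / u), Prod.ext ?_ ?_⟩
  · simp only [move]; field_simp; ring
  · simp only [move]; field_simp; ring

theorem move_injective (p : ℝ × ℂ) {u : ℂ} (hu : u ≠ 0) : Function.Injective (move p u) := by
  intro a b h
  have hu' : ‖u‖ ≠ 0 := norm_ne_zero_iff.2 hu
  obtain ⟨h₁, h₂⟩ := Prod.mk.inj h
  exact Prod.ext (sub_left_inj.1 (mul_left_cancel₀ hu' h₁))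
    (sub_left_inj.1 (mul_left_cancel₀ hu h₂))

theorem move_fst_sub (p a b : ℝ × ℂ) (u : ℂ) :
    (move p u a).1 - (move p u b).1 = ‖u‖ * (a.1 - b.1) := by
  simp only [move]; ring

theorem norm_move_snd_sub (p a b : ℝ × ℂ) (u : ℂ) :
    ‖(move p u a).2 - (move p u b).2‖ = ‖u‖ * ‖a.2 - b.2‖ := by
  rw [← norm_mul]; simp only [move]; congr 1; ring

theorem move_fst_le (p : ℝ × ℂ) {a b : ℝ × ℂ} {u : ℂ} (hu : u ≠ 0) :
    (move p u a).1 ≤ (move p u b).1 ↔ a.1 ≤ b.1 := by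
  have hu' : 0 < ‖u‖ := norm_pos_iff.2 hu
  rw [← sub_nonneg, move_fst_sub, mul_nonneg_iff_of_pos_left hu', sub_nonneg]

/-- Spatial distances and time differences are scaled by the same factor `‖u‖`, so the speeds stay
unchanged. -/
theorem rimPoint_move_iff {o p q r s z : ℝ × ℂ} {v w : ℝ} {u : ℂ} (hu : u ≠ 0) :
    RimPoint (move o u p) (move o u q) v (move o u r) (move o u s) w (move o u z) ↔
      RimPoint p q v r s w z := by
  have hu' : 0 < ‖u‖ := norm_pos_iff.2 hu
  have e : ∀ a b : ℝ × ℂ, v * ((move o u a).1 - (move o u b).1) = ‖u‖ * (v * (a.1 - b.1)) :=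
    fun a b => by rw [move_fst_sub]; ring
  have e' : ∀ a b : ℝ × ℂ, w * ((move o u a).1 - (move o u b).1) = ‖u‖ * (w * (a.1 - b.1)) :=
    fun a b => by rw [move_fst_sub]; ring
  simp only [RimPoint, rim, Set.mem_ofPred_eq, upGap, downGap, e, e', norm_move_snd_sub,
    move_fst_le o hu, ← mul_sub, mul_pow, mul_eq_zero, hu'.ne', false_or]
  rw [mul_right_inj' (pow_ne_zero 2 hu'.ne'),
    mul_le_mul_iff_right₀ (pow_pos hu' 2)]

theorem exceptional_of_move {p q r : ℝ × ℂ} {v w : ℝ} {u : ℂ} (hu : u ≠ 0)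
    (h : Exceptional 0 (move p u q) v (move p u r) w) : Exceptional p q v r w := by
  have hu' : 0 < ‖u‖ := norm_pos_iff.2 hu
  rw [← move_self p u] at h
  rcases h with h | h | ⟨h₁, h₂, c, h₃⟩ | ⟨h₁, h₂, h₃⟩
  · exact .inl (move_injective p hu h)
  · exact .inr (.inl (move_injective p hu h))
  · refine .inr (.inr (.inl ⟨?_, h₂, c, move_injective p hu ?_⟩))
    · rw [norm_move_snd_sub, move_fst_sub] at h₁
      exact mul_left_cancel₀ hu'.ne' (by linarith)
    · rw [h₃, move_self]
      refine Prod.ext ?_ ?_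
      · simp [move]; ring
      · simp [move]; ring
  · have key : ∀ a : ℝ × ℂ, (move p u a).2 = (move p u p).2 → a.2 = p.2 := fun a ha =>
      sub_left_inj.1 (mul_left_cancel₀ hu ha)
    refine .inr (.inr (.inr ⟨key _ h₁, key _ h₂, ?_⟩))
    rw [move_fst_sub] at h₃
    have : (move p u p).1 + (move p u q).1 - 2 * (move p u r).1 =
        ‖u‖ * (p.1 + q.1 - 2 * r.1) := by simp only [move]; ring
    rw [this, abs_mul, abs_norm] at h₃
    exact mul_left_cancel₀ hu'.ne' (by linarith)

/-- Multiplication by the conjugate of the difference `q - p` turns this direction into the positive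
real axis and scales by its length. -/
theorem rotated_val (p q z : Pt n) : (rotated p q z).val env =
    move (p.val env) ((starRingEnd ℂ) ((q.val env).2 - (p.val env).2)) (z.val env) := by
  have hn : ‖(starRingEnd ℂ) ((q.val env).2 - (p.val env).2)‖ =
      √((q.x.eval env - p.x.eval env) ^ 2 + (q.y.eval env - p.y.eval env) ^ 2) := by
    rw [RCLike.norm_conj, ← Real.sqrt_sq (norm_nonneg _), norm_sub_sq_coord]
    rfl
  refine Prod.ext ?_ (Complex.ext ?_ ?_)
  · simp only [move, hn]
    simp [rotated, Pt.val, mul_comm]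
  · simp [rotated, Pt.val, move]; ring
  · simp [rotated, Pt.val, move]; ring

theorem translated_val (p z : Pt n) :
    (translated p z).val env = move (p.val env) 1 (z.val env) := by
  refine Prod.ext ?_ (Complex.ext ?_ ?_) <;> simp [translated, Pt.val, move]

/-- The change of coordinates in `inCoordinates` is one of the maps `move`. -/
theorem exists_move (p q r s : Pt n) (φ : Pt n → Pt n → Pt n → Fm n)
    (ht : p.t.eval env < q.t.eval env) :
    ∃ (u : ℂ) (q' r' s' : Pt n), u ≠ 0 ∧ q'.y.eval env = 0 ∧ 0 < q'.t.eval env ∧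
      q'.val env = move (p.val env) u (q.val env) ∧ r'.val env = move (p.val env) u (r.val env) ∧
      s'.val env = move (p.val env) u (s.val env) ∧
      ((inCoordinates p q r s φ).Holds env ↔ (φ q' r' s').Holds env) := by
  by_cases h : q.y.eval env = p.y.eval env
  · refine ⟨1, _, _, _, one_ne_zero, ?_, ?_, translated_val p q, translated_val p r,
      translated_val p s, ?_⟩
    · simp [translated, h]
    · simp [translated, ht]
    · simp [inCoordinates, Fm.Holds, h]
  · have hpos : 0 < (q.x.eval env - p.x.eval env) ^ 2 + (q.y.eval env - p.y.eval env) ^ 2 := by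
      have := sub_ne_zero.2 h
      positivity
    refine ⟨_, _, _, _, ?_, ?_, ?_, rotated_val p q q, rotated_val p q r, rotated_val p q s, ?_⟩
    · rw [Ne, map_eq_zero, sub_eq_zero]
      exact fun h' => h (congrArg Complex.im h')
    · simp only [rotated, Tm.eval_add, Tm.eval_sub, Tm.eval_mul]; ring
    · simp only [rotated, Tm.eval_add, Tm.eval_sub, Tm.eval_mul, Tm.eval_sqrt, Tm.eval_pow]
      exact mul_pos (sub_pos.2 ht) (Real.sqrt_pos.2 hpos)
    · simp [inCoordinates, Fm.Holds, h]

/-- The subformula of `PhiII` for the rim of the first bead. -/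
def rimFm (p q : Pt n) (v : Tm n) (r s : Pt n) (w : Tm n) : Fm n :=
  inCoordinates p q r s fun q r s => (phiRhoMantel q v r s w).or (phiRhoMantel q v s r w)

theorem exists_rimPoint_of_rimFm {p q r s : Pt n} {v w : Tm n} (hv : 0 < v.eval env)
    (ht : p.t.eval env < q.t.eval env) (h : (rimFm p q v r s w).Holds env) :
    ∃ z, RimPoint (p.val env) (q.val env) (v.eval env) (r.val env) (s.val env) (w.eval env) z ∨
      RimPoint (p.val env) (q.val env) (v.eval env) (s.val env) (r.val env) (w.eval env) z := by
  obtain ⟨u, q', r', s', hu, hy, ht', eq, er, es, hiff⟩ := exists_move p q r s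
    (fun q r s => (phiRhoMantel q v r s w).or (phiRhoMantel q v s r w)) ht
  rcases hiff.1 h with h | h
  · obtain ⟨z, hz⟩ := exists_rimPoint_of_holds hv ht' hy h
    obtain ⟨z, rfl⟩ := move_surjective (p.val env) hu z
    rw [eq, er, es, ← move_self (p.val env) u, rimPoint_move_iff hu] at hz
    exact ⟨z, .inl hz⟩
  · obtain ⟨z, hz⟩ := exists_rimPoint_of_holds hv ht' hy h
    obtain ⟨z, rfl⟩ := move_surjective (p.val env) hu z
    rw [eq, er, es, ← move_self (p.val env) u, rimPoint_move_iff hu] at hz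
    exact ⟨z, .inr hz⟩

theorem exceptional_or_rimFm {p q r s : Pt n} {v w : Tm n} {z : ℝ × ℂ} (hv : 0 < v.eval env)
    (hw : 0 < w.eval env) (ht : p.t.eval env < q.t.eval env)
    (h : RimPoint (p.val env) (q.val env) (v.eval env) (r.val env) (s.val env) (w.eval env) z) :
    Exceptional (p.val env) (q.val env) (v.eval env) (r.val env) (w.eval env) ∨
      (rimFm p q v r s w).Holds env := by
  obtain ⟨u, q', r', s', hu, hy, ht', eq, er, es, hiff⟩ := exists_move p q r s
    (fun q r s => (phiRhoMantel q v r s w).or (phiRhoMantel q v s r w)) ht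
  rw [← rimPoint_move_iff (o := p.val env) hu, move_self, ← eq, ← er, ← es] at h
  rcases exceptional_or_holds hv hw ht' hy h with h | h
  · rw [eq, er] at h
    exact .inl (exceptional_of_move hu h)
  · exact .inr (hiff.2 (.inl h))

theorem exceptional_or_rimFm' {p q r s : Pt n} {v w : Tm n} {z : ℝ × ℂ} (hv : 0 < v.eval env)
    (hw : 0 < w.eval env) (ht : p.t.eval env < q.t.eval env)
    (h : RimPoint (p.val env) (q.val env) (v.eval env) (s.val env) (r.val env) (w.eval env) z) :
    Exceptional (p.val env) (q.val env) (v.eval env) (s.val env) (w.eval env) ∨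
      (rimFm p q v r s w).Holds env := by
  obtain ⟨u, q', r', s', hu, hy, ht', eq, er, es, hiff⟩ := exists_move p q r s
    (fun q r s => (phiRhoMantel q v r s w).or (phiRhoMantel q v s r w)) ht
  rw [← rimPoint_move_iff (o := p.val env) hu, move_self, ← eq, ← er, ← es] at h
  rcases exceptional_or_holds hv hw ht' hy h with h | h
  · rw [eq, es] at h
    exact .inl (exceptional_of_move hu h)
  · exact .inr (hiff.2 (.inr h))

/-! ### Beads in squared form and apex containment -/

theorem holds_eq_zero_iff {t : Tm n} : (Fm.eq t 0).Holds env ↔ t.eval env = 0 := by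
  rw [Fm.Holds, Tm.eval_zero]

/-- The time bounds make both sides of each cone inequality non-negative, so squaring is reversible,
also at speed zero. -/
theorem mem_prism_iff_sq {p q z : ℝ × ℂ} {v : ℝ} (hv : 0 ≤ v) :
    z ∈ prism p q v ↔ ‖z.2 - p.2‖ ^ 2 ≤ (z.1 - p.1) ^ 2 * v ^ 2 ∧
      ‖z.2 - q.2‖ ^ 2 ≤ (q.1 - z.1) ^ 2 * v ^ 2 ∧ p.1 ≤ z.1 ∧ z.1 ≤ q.1 := by
  have key : ∀ {a b : ℝ}, 0 ≤ a → 0 ≤ b → (a - v * b ≤ 0 ↔ a ^ 2 ≤ b ^ 2 * v ^ 2) := by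
    intro a b ha hb
    rw [sub_nonpos, ← pow_le_pow_iff_left₀ ha (mul_nonneg hv hb) two_ne_zero, mul_pow, mul_comm]
  simp only [prism, mem_ofPred_eq, upGap, downGap]
  constructor
  · rintro ⟨h₁, h₂, h₃, h₄⟩
    exact ⟨(key (norm_nonneg _) (sub_nonneg.2 h₃)).1 h₁, (key (norm_nonneg _) (sub_nonneg.2 h₄)).1 h₂,
      h₃, h₄⟩
  · rintro ⟨h₁, h₂, h₃, h₄⟩
    exact ⟨(key (norm_nonneg _) (sub_nonneg.2 h₃)).2 h₁, (key (norm_nonneg _) (sub_nonneg.2 h₄)).2 h₂,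
      h₃, h₄⟩

theorem mem_bead_iff {tp xp yp tq xq yq v t x y : ℝ} (hv : 0 ≤ v) :
    (t, x, y) ∈ bead tp xp yp tq xq yq v ↔
      ((t, ⟨x, y⟩) : ℝ × ℂ) ∈ prism (tp, ⟨xp, yp⟩) (tq, ⟨xq, yq⟩) v := by
  rw [mem_prism_iff_sq hv, norm_sub_sq_coord, norm_sub_sq_coord]
  rfl

theorem holds_psiB_iff {z p q : Pt n} {v : Tm n} (hv : 0 ≤ v.eval env) :
    (psiB z p q v).Holds env ↔ z.val env ∈ prism (p.val env) (q.val env) (v.eval env) := by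
  rw [mem_prism_iff_sq hv, norm_sub_sq_coord, norm_sub_sq_coord]
  rfl

theorem holds_PhiI_iff {p q r s : Pt n} {v w : Tm n} (hv : 0 ≤ v.eval env)
    (hw : 0 ≤ w.eval env) : (PhiI p q v r s w).Holds env ↔
      (r.val env ∈ prism (p.val env) (q.val env) (v.eval env) ∨
        s.val env ∈ prism (p.val env) (q.val env) (v.eval env)) ∨
      (p.val env ∈ prism (r.val env) (s.val env) (w.eval env) ∨
        q.val env ∈ prism (r.val env) (s.val env) (w.eval env)) := by
  simp only [PhiI, Fm.Holds, holds_psiB_iff hv, holds_psiB_iff hw]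

/-! ## Contacts -/

theorem eval_tmDist (p r : Pt n) : (tmDist p r).eval env = ‖(p.val env).2 - (r.val env).2‖ := by
  rw [← Real.sqrt_sq (norm_nonneg _), norm_sub_sq_coord]
  rfl

/-- If the distance of two points is the sum of the distances to a third one, that one is the
corresponding convex combination. -/
theorem contact_coord {a b : ℝ} {p r z : ℂ} (h₁ : ‖z - p‖ ≤ a) (h₂ : ‖z - r‖ ≤ b)
    (h : ‖p - r‖ = a + b) : (a + b) * z.re = b * p.re + a * r.re ∧
      (a + b) * z.im = b * p.im + a * r.im ∧ ‖z - p‖ = a ∧ ‖z - r‖ = b := by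
  have htri := norm_sub_le (z - r) (z - p)
  rw [show z - r - (z - p) = p - r by ring, h] at htri
  have ea : ‖z - p‖ = a := by linarith
  have eb : ‖z - r‖ = b := by linarith
  have sa := congrArg (· ^ 2) ea
  have sb := congrArg (· ^ 2) eb
  have sd := congrArg (· ^ 2) h
  simp only [norm_sub_sq_coord] at sa sb sd
  -- The equality case of the triangle inequality, from the identity `|b(z-p) + a(z-r)|² =
  -- (b²+ab)|z-p|² + (a²+ab)|z-r|² - ab|p-r|²`.
  have hsq : ((a + b) * z.re - (b * p.re + a * r.re)) ^ 2 +
      ((a + b) * z.im - (b * p.im + a * r.im)) ^ 2 = 0 := by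
    linear_combination (b ^ 2 + a * b) * sa + (a ^ 2 + a * b) * sb - a * b * sd
  have e₁ : ((a + b) * z.re - (b * p.re + a * r.re)) ^ 2 = 0 := by
    linarith [sq_nonneg ((a + b) * z.re - (b * p.re + a * r.re)),
      sq_nonneg ((a + b) * z.im - (b * p.im + a * r.im))]
  have e₂ : ((a + b) * z.im - (b * p.im + a * r.im)) ^ 2 = 0 := by linarith
  exact ⟨sub_eq_zero.1 (by simpa using e₁), sub_eq_zero.1 (by simpa using e₂), ea, eb⟩

/-- The coordinates of the first contact, multiplied by `(v + w) d`. -/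
theorem contact_scaled {v w t tp tr d x xp xr : ℝ} (hd : d = v * (t - tp) + w * (t - tr))
    (h : d * x = w * (t - tr) * xp + v * (t - tp) * xr) :
    (v + w) * d * x = (xp * w + xr * v) * d + v * ((tr - tp) * w) * (xr - xp) := by
  linear_combination (v + w) * h - (w * xp + v * xr) * hd

/-- For the first contact `(t, x, y)`, the subformula `phiMinus` is a half-space condition. -/
theorem phiMinus_iff {v w t tp tr d x y xp yp xr yr ta xa ya tb xb yb u : ℝ}
    (hd : d = v * (t - tp) + w * (t - tr))
    (hx : d * x = w * (t - tr) * xp + v * (t - tp) * xr)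
    (hy : d * y = w * (t - tr) * yp + v * (t - tp) * yr)
    (ha : (x - xa) ^ 2 + (y - ya) ^ 2 = (t - ta) ^ 2 * u ^ 2) :
    2 * (xa - xb) * ((xp * w + xr * v) * d + v * ((tr - tp) * w) * (xr - xp)) +
        2 * (ya - yb) * ((yp * w + yr * v) * d + v * ((tr - tp) * w) * (yr - yp)) +
        d * (v + w) * (xb ^ 2 - xa ^ 2 + yb ^ 2 - ya ^ 2) ≤
      u ^ 2 * ((tb ^ 2 - ta ^ 2) * (v + w) + 2 * (d + tp * v + tr * w) * (ta - tb)) * d ↔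
    (v + w) * d * ((x - xb) ^ 2 + (y - yb) ^ 2) ≤ (v + w) * d * ((tb - t) ^ 2 * u ^ 2) := by
  have hτ : d + tp * v + tr * w = (v + w) * t := by linear_combination hd
  rw [← contact_scaled hd hx, ← contact_scaled hd hy, hτ]
  have e₁ : 2 * (xa - xb) * ((v + w) * d * x) + 2 * (ya - yb) * ((v + w) * d * y) +
      d * (v + w) * (xb ^ 2 - xa ^ 2 + yb ^ 2 - ya ^ 2) =
      (v + w) * d * ((x - xb) ^ 2 + (y - yb) ^ 2) - (v + w) * d * ((t - ta) ^ 2 * u ^ 2) := by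
    rw [← ha]; ring
  have e₂ : u ^ 2 * ((tb ^ 2 - ta ^ 2) * (v + w) + 2 * ((v + w) * t) * (ta - tb)) * d =
      (v + w) * d * ((tb - t) ^ 2 * u ^ 2) - (v + w) * d * ((t - ta) ^ 2 * u ^ 2) := by ring
  rw [e₁, e₂, sub_le_sub_iff_right]

/-- The formula `psiICMinus` in terms of the first contact `z`. -/
theorem holds_psiICMinus_iff {p q r s : Pt n} {v w : Tm n} {z : ℝ × ℂ}
    (hvw : 0 < v.eval env + w.eval env)
    (h₁ : ‖z.2 - (p.val env).2‖ ≤ v.eval env * (z.1 - (p.val env).1))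
    (h₂ : ‖z.2 - (r.val env).2‖ ≤ w.eval env * (z.1 - (r.val env).1))
    (h : ‖(p.val env).2 - (r.val env).2‖ =
      v.eval env * (z.1 - (p.val env).1) + w.eval env * (z.1 - (r.val env).1)) :
    (psiICMinus p q v r s w).Holds env ↔
      (((p.val env).1 ≤ z.1 ∧ z.1 ≤ (q.val env).1) ∧ (r.val env).1 ≤ z.1 ∧ z.1 ≤ (s.val env).1) ∧
      (v.eval env + w.eval env) * ‖(p.val env).2 - (r.val env).2‖ * ‖z.2 - (q.val env).2‖ ^ 2 ≤
        (v.eval env + w.eval env) * ‖(p.val env).2 - (r.val env).2‖ *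
          (((q.val env).1 - z.1) ^ 2 * v.eval env ^ 2) ∧
      (v.eval env + w.eval env) * ‖(p.val env).2 - (r.val env).2‖ * ‖z.2 - (s.val env).2‖ ^ 2 ≤
        (v.eval env + w.eval env) * ‖(p.val env).2 - (r.val env).2‖ *
          (((s.val env).1 - z.1) ^ 2 * w.eval env ^ 2) := by
  obtain ⟨hx, hy, ea, eb⟩ := contact_coord h₁ h₂ h
  rw [← h] at hx hy
  have sa : (z.2.re - (p.val env).2.re) ^ 2 + (z.2.im - (p.val env).2.im) ^ 2 =
      (z.1 - (p.val env).1) ^ 2 * v.eval env ^ 2 := by rw [← norm_sub_sq_coord, ea]; ring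
  have sb : (z.2.re - (r.val env).2.re) ^ 2 + (z.2.im - (r.val env).2.im) ^ 2 =
      (z.1 - (r.val env).1) ^ 2 * w.eval env ^ 2 := by rw [← norm_sub_sq_coord, eb]; ring
  have iq := phiMinus_iff (xb := (q.val env).2.re) (yb := (q.val env).2.im)
    (tb := (q.val env).1) h hx hy sa
  have is := phiMinus_iff (xb := (s.val env).2.re) (yb := (s.val env).2.im)
    (tb := (s.val env).1) h hx hy sb
  have hτ : ‖(p.val env).2 - (r.val env).2‖ + (p.val env).1 * v.eval env +
      (r.val env).1 * w.eval env = z.1 * (v.eval env + w.eval env) := by linear_combination h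
  have lo : ∀ a : ℝ, a * (v.eval env + w.eval env) ≤ ‖(p.val env).2 - (r.val env).2‖ +
      (p.val env).1 * v.eval env + (r.val env).1 * w.eval env ↔ a ≤ z.1 := fun a => by
    rw [hτ]; exact mul_le_mul_iff_left₀ hvw
  have hi : ∀ a : ℝ, ‖(p.val env).2 - (r.val env).2‖ + (p.val env).1 * v.eval env +
      (r.val env).1 * w.eval env ≤ a * (v.eval env + w.eval env) ↔ z.1 ≤ a := fun a => by
    rw [hτ]; exact mul_le_mul_iff_left₀ hvw
  rw [norm_sub_sq_coord, norm_sub_sq_coord, ← iq, ← is, ← lo, ← hi, ← lo, ← hi]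
  simp only [psiICMinus, psiTime, phiMinus, Fm.Holds, Tm.eval_add, Tm.eval_sub, Tm.eval_mul,
    Tm.eval_pow, Tm.eval_two, eval_tmDist]
  rfl

theorem holds_psiICMinus_of_firstContact {p q r s : Pt n} {v w : Tm n} (hv : 0 ≤ v.eval env)
    (hw : 0 ≤ w.eval env) (hvw : v.eval env + w.eval env ≠ 0)
    (h : FirstContact (p.val env) (q.val env) (v.eval env) (r.val env) (s.val env) (w.eval env)) :
    (psiICMinus p q v r s w).Holds env := by
  obtain ⟨z, h₁, h₂, h⟩ := h
  have hvw : 0 < v.eval env + w.eval env := lt_of_le_of_ne (by positivity) hvw.symm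
  rw [holds_psiICMinus_iff hvw (sub_nonpos.1 h₁.1) (sub_nonpos.1 h₂.1) h]
  have g₁ := (mem_prism_iff_sq hv).1 h₁
  have g₂ := (mem_prism_iff_sq hw).1 h₂
  exact ⟨⟨g₁.2.2, g₂.2.2⟩, mul_le_mul_of_nonneg_left g₁.2.1 (by positivity),
    mul_le_mul_of_nonneg_left g₂.2.1 (by positivity)⟩

theorem eq_of_mem_prism_zero {E : Type*} [NormedAddCommGroup E] [InnerProductSpace ℝ E]
    {p q z : ℝ × E} (h : z ∈ prism p q 0) : p.2 = z.2 ∧ q.2 = z.2 := by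
  obtain ⟨h₁, h₂, -, -⟩ := h
  rw [upGap, zero_mul, sub_zero] at h₁
  rw [downGap, zero_mul, sub_zero] at h₂
  exact ⟨(sub_eq_zero.1 (norm_le_zero_iff.1 h₁)).symm, (sub_eq_zero.1 (norm_le_zero_iff.1 h₂)).symm⟩

theorem mem_prism_zero_iff {E : Type*} [NormedAddCommGroup E] [InnerProductSpace ℝ E]
    {p q z : ℝ × E} : z ∈ prism p q 0 ↔ (p.2 = z.2 ∧ q.2 = z.2) ∧ p.1 ≤ z.1 ∧ z.1 ≤ q.1 := by
  refine ⟨fun h => ⟨eq_of_mem_prism_zero h, h.2.2⟩, fun ⟨⟨h₁, h₂⟩, h₃⟩ => ⟨?_, ?_, h₃⟩⟩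
  · simp [upGap, h₁]
  · simp [downGap, h₂]

/-- For `d > 0` one can divide by `(v + w) d` and obtains the contact point. For `d = 0` only the
time conditions carry information. They place the origin of one bead in the other if a speed is
zero, and force the two origins to coincide if both are positive. -/
theorem nonempty_of_holds_psiICMinus {p q r s : Pt n} {v w : Tm n} (hv : 0 ≤ v.eval env)
    (hw : 0 ≤ w.eval env) (hvw : v.eval env + w.eval env ≠ 0)
    (hp : p.val env ∈ prism (p.val env) (q.val env) (v.eval env))
    (hr : r.val env ∈ prism (r.val env) (s.val env) (w.eval env))
    (h : (psiICMinus p q v r s w).Holds env) :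
    (prism (p.val env) (q.val env) (v.eval env) ∩
      prism (r.val env) (s.val env) (w.eval env)).Nonempty := by
  have hvw : 0 < v.eval env + w.eval env := lt_of_le_of_ne (by positivity) hvw.symm
  obtain ⟨⟨⟨t₁, t₂⟩, t₃, t₄⟩, -, -⟩ := id h
  simp only [Fm.Holds, Tm.eval_add, Tm.eval_mul, eval_tmDist] at t₁ t₂ t₃ t₄
  change (p.val env).1 * _ ≤ _ + (p.val env).1 * _ + (r.val env).1 * _ at t₁
  change _ + (p.val env).1 * _ + (r.val env).1 * _ ≤ (q.val env).1 * _ at t₂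
  change (r.val env).1 * _ ≤ _ + (p.val env).1 * _ + (r.val env).1 * _ at t₃
  change _ + (p.val env).1 * _ + (r.val env).1 * _ ≤ (s.val env).1 * _ at t₄
  set P := p.val env with hP
  set R := r.val env with hR
  set d := ‖P.2 - R.2‖ with hd
  rcases (norm_nonneg (P.2 - R.2)).eq_or_lt with h0 | hpos
  · have hPR : P.2 = R.2 := sub_eq_zero.1 (norm_eq_zero.1 h0.symm)
    rw [← hd] at h0
    rw [← h0] at t₁ t₂ t₃ t₄
    rcases hv.eq_or_lt with hv0 | hv
    · rw [← hv0] at hp hvw t₁ t₂ ⊢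
      rw [zero_add] at hvw
      refine ⟨R, mem_prism_zero_iff.2 ⟨?_, ?_, ?_⟩, hr⟩
      · rw [← hPR]; exact eq_of_mem_prism_zero hp
      · nlinarith
      · nlinarith
    rcases hw.eq_or_lt with hw0 | hw
    · rw [← hw0] at hr t₃ t₄ ⊢
      refine ⟨P, hp, mem_prism_zero_iff.2 ⟨?_, ?_, ?_⟩⟩
      · rw [hPR]; exact eq_of_mem_prism_zero hr
      · nlinarith
      · nlinarith
    · have : P = R := Prod.ext (le_antisymm (by nlinarith) (by nlinarith)) hPR
      exact ⟨P, hp, by rw [this]; exact hr⟩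
  · set t := (d + P.1 * v.eval env + R.1 * w.eval env) / (v.eval env + w.eval env) with ht
    have htm : (v.eval env + w.eval env) * t = d + P.1 * v.eval env + R.1 * w.eval env := by
      rw [ht]; field_simp
    rw [← htm, mul_comm, mul_le_mul_iff_right₀ hvw] at t₁ t₃
    have hdt : d = v.eval env * (t - P.1) + w.eval env * (t - R.1) := by linarith
    obtain ⟨x, hx₁, hx₂⟩ := exists_norm_sub_le P.2 R.2 (mul_nonneg hv (sub_nonneg.2 t₁))
      (mul_nonneg hw (sub_nonneg.2 t₃)) hdt.le
    obtain ⟨⟨g₁, g₂⟩, g₃, g₄⟩ := (holds_psiICMinus_iff (z := (t, x)) hvw hx₁ hx₂ hdt).1 h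
    have hc : 0 < (v.eval env + w.eval env) * d := mul_pos hvw hpos
    have k₁ := le_of_mul_le_mul_left g₃ hc
    have k₂ := le_of_mul_le_mul_left g₄ hc
    have sq : ∀ {a b u : ℝ}, 0 ≤ a → a ≤ u * b → a ^ 2 ≤ b ^ 2 * u ^ 2 := fun {a b u} ha hab => by
      rw [← mul_pow, mul_comm b]; exact pow_le_pow_left₀ ha hab 2
    exact ⟨(t, x), (mem_prism_iff_sq hv).2 ⟨sq (norm_nonneg _) hx₁, k₁, g₁⟩,
      (mem_prism_iff_sq hw).2 ⟨sq (norm_nonneg _) hx₂, k₂, g₂⟩⟩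

theorem rev_val (p : Pt n) : p.rev.val env = rev (p.val env) := rfl

theorem holds_psiICPlus_of_lastContact {p q r s : Pt n} {v w : Tm n} (hv : 0 ≤ v.eval env)
    (hw : 0 ≤ w.eval env) (hvw : v.eval env + w.eval env ≠ 0)
    (h : LastContact (p.val env) (q.val env) (v.eval env) (r.val env) (s.val env) (w.eval env)) :
    (psiICPlus p q v r s w).Holds env := by
  refine holds_psiICMinus_of_firstContact hv hw hvw ?_
  simp only [rev_val]
  exact LastContact.of_rev (by simpa only [rev_rev] using h)

theorem nonempty_of_holds_psiICPlus {p q r s : Pt n} {v w : Tm n} (hv : 0 ≤ v.eval env)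
    (hw : 0 ≤ w.eval env) (hvw : v.eval env + w.eval env ≠ 0)
    (hq : q.val env ∈ prism (p.val env) (q.val env) (v.eval env))
    (hs : s.val env ∈ prism (r.val env) (s.val env) (w.eval env))
    (h : (psiICPlus p q v r s w).Holds env) :
    (prism (p.val env) (q.val env) (v.eval env) ∩
      prism (r.val env) (s.val env) (w.eval env)).Nonempty := by
  unfold psiICPlus at h
  have := nonempty_of_holds_psiICMinus hv hw hvw
    (by rw [rev_val, rev_val]; exact rev_mem_prism hq)
    (by rw [rev_val, rev_val]; exact rev_mem_prism hs) h
  simp only [rev_val] at this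
  obtain ⟨z, h₁, h₂⟩ := this
  exact ⟨rev z, mem_prism_rev.1 h₁, mem_prism_rev.1 h₂⟩

/-! ## The rim and the mantel -/

theorem mem_prism_of_rimPoint {p q r s z : ℝ × ℂ} {v w : ℝ} (hv : 0 < v) (hw : 0 < w)
    (hrs : r.1 ≤ s.1) (h : RimPoint p q v r s w z ∨ RimPoint p q v s r w z) :
    z ∈ prism p q v ∩ prism r s w := by
  have key : z ∈ rim p q v ∧ ‖z.2 - r.2‖ ^ 2 ≤ (w * (z.1 - r.1)) ^ 2 ∧
      ‖z.2 - s.2‖ ^ 2 ≤ (w * (z.1 - s.1)) ^ 2 ∧ r.1 ≤ z.1 ∧ z.1 ≤ s.1 := by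
    rcases h with ⟨h₁, h₂, h₃, h₄⟩ | ⟨h₁, h₂, h₃, h₄⟩
    · refine ⟨h₁, h₂.le, h₃, ?_⟩
      rcases h₄ with h | h
      · exact h
      -- As `r.1 ≤ s.1`, the opposite order of times is possible only if all three times agree.
      · constructor <;> linarith
    · refine ⟨h₁, h₃, h₂.le, ?_⟩
      rcases h₄ with h | h
      · constructor <;> linarith
      · exact h
  obtain ⟨h₁, h₂, h₃, h₄⟩ := key
  exact ⟨rim_subset_prism hv h₁, (mem_prism_iff_sq hw.le).2
    ⟨h₂.trans_eq (by ring), h₃.trans_eq (by ring), h₄⟩⟩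

/-- A rim point on the mantel satisfies the formula for rim and mantel, or one of the contacts lies
in both beads. -/
theorem rimFm_or_contact {p q r s : Pt n} {v w : Tm n} (hv : 0 < v.eval env)
    (hw : 0 < w.eval env) (ht : p.t.eval env < q.t.eval env)
    (hp : p.val env ∉ prism (r.val env) (s.val env) (w.eval env))
    (hq : q.val env ∉ prism (r.val env) (s.val env) (w.eval env))
    (hr : r.val env ∉ prism (p.val env) (q.val env) (v.eval env))
    (hs : s.val env ∉ prism (p.val env) (q.val env) (v.eval env))
    (h : RimMantel (p.val env) (q.val env) (v.eval env) (r.val env) (s.val env) (w.eval env)) :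
    (rimFm p q v r s w).Holds env ∨
      FirstContact (p.val env) (q.val env) (v.eval env) (r.val env) (s.val env) (w.eval env) ∨
      LastContact (p.val env) (q.val env) (v.eval env) (r.val env) (s.val env) (w.eval env) := by
  obtain ⟨z, hz₁, hz₂, hz⟩ := h
  have hzp := rim_subset_prism hv hz₁
  obtain ⟨g₁, g₂, g₃, g₄⟩ := (mem_prism_iff_sq hw.le).1 hz₂
  rcases hz with hz | hz
  · have hpt : RimPoint (p.val env) (q.val env) (v.eval env) (r.val env) (s.val env) (w.eval env) z :=
      ⟨hz₁, by rw [sub_eq_zero.1 hz], g₂.trans_eq (by ring), .inl ⟨g₃, g₄⟩⟩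
    -- The conditions on the apexes exclude every exceptional position but the coaxial one, where a
    -- contact replaces the missing root.
    rcases exceptional_or_rimFm hv hw ht hpt with (h | h | ⟨h₁, h₂, c, h₃⟩ | ⟨h₁, h₂, h₃⟩) | h
    · exact absurd (by rw [h]; exact left_mem_prism hzp) hr
    · exact absurd (by rw [h]; exact right_mem_prism hzp) hr
    · rw [h₂] at hp hz₂
      exact (false_of_collinear hv h₁ h₃ hp hr hzp hz₂).elim
    · exact .inr (.inr (lastContact_of_coaxial hv hw h₁ h₂ h₃ hq hs hz₁ hz₂))
    · exact .inl h
  · have hpt : RimPoint (p.val env) (q.val env) (v.eval env) (s.val env) (r.val env) (w.eval env) z :=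
      ⟨hz₁, by rw [sub_eq_zero.1 hz]; ring, g₁.trans_eq (by ring), .inr ⟨g₃, g₄⟩⟩
    rcases exceptional_or_rimFm' hv hw ht hpt with (h | h | ⟨h₁, h₂, c, h₃⟩ | ⟨h₁, h₂, h₃⟩) | h
    · exact absurd (by rw [h]; exact left_mem_prism hzp) hs
    · exact absurd (by rw [h]; exact right_mem_prism hzp) hs
    · rw [h₂] at hq hz₂
      -- Time reversal exchanges `p` and `q`, so the parameter on their line changes from `c` to `1
      -- - c`.
      refine (false_of_collinear (p := rev (q.val env)) (q := rev (p.val env))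
        (r := rev (s.val env)) (s := rev (r.val env)) (z := rev z) (c := 1 - c) hv ?_ ?_ ?_ ?_
        (rev_mem_prism hzp) (rev_mem_prism hz₂)).elim
      · simp only [rev_fst, rev_snd]
        rw [norm_sub_rev, h₁]; ring
      · rw [h₃]
        refine Prod.ext ?_ ?_
        · simp; ring
        · simp; ring
      · rwa [mem_prism_rev, rev_rev]
      · rwa [mem_prism_rev, rev_rev]
    · exact .inr (.inl (firstContact_of_coaxial hv hw h₁ h₂ h₃ hp hr hz₁ hz₂))
    · exact .inl h

/-! ### The equivalence -/

theorem fst_lt_of_not_mem {E : Type*} [NormedAddCommGroup E] [InnerProductSpace ℝ E]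
    {p q r s z : ℝ × E} {v w : ℝ} (hp : p ∉ prism r s w) (h₁ : z ∈ prism p q v)
    (h₂ : z ∈ prism r s w) : p.1 < q.1 := by
  -- If `p.1 = q.1`, the common point `z` coincides with `p`, so the apex `p` would lie in the other
  -- bead.
  refine lt_of_le_of_ne (h₁.2.2.1.trans h₁.2.2.2) fun h => hp ?_
  rwa [← eq_of_upGap_of_fst h₁.1 (le_antisymm (h ▸ h₁.2.2.2) h₁.2.2.1)]

theorem holds_psiAlibiTm_iff {p q r s : Pt n} {v w : Tm n} (hv : 0 ≤ v.eval env)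
    (hw : 0 ≤ w.eval env)
    (hB₁ : (prism (p.val env) (q.val env) (v.eval env)).Nonempty)
    (hB₂ : (prism (r.val env) (s.val env) (w.eval env)).Nonempty) :
    (psiAlibiTm p q v r s w).Holds env ↔
      prism (p.val env) (q.val env) (v.eval env) ∩ prism (r.val env) (s.val env) (w.eval env) = ∅ := by
  obtain ⟨b₁, hb₁⟩ := hB₁
  obtain ⟨b₂, hb₂⟩ := hB₂
  have hp := left_mem_prism hb₁
  have hq := right_mem_prism hb₁
  have hr := left_mem_prism hb₂
  have hs := right_mem_prism hb₂
  rw [← not_nonempty_iff_eq_empty]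
  refine not_congr ?_
  have hI := holds_PhiI_iff (p := p) (q := q) (r := r) (s := s) hv hw
  constructor
  · rintro (⟨⟨ht₁, ht₂⟩, h | h⟩ | h)
    · obtain ⟨hvw, -, h⟩ := h
      replace hvw := mt holds_eq_zero_iff.2 hvw
      rcases h with h | h
      · exact nonempty_of_holds_psiICMinus hv hw hvw hp hr h
      · exact nonempty_of_holds_psiICPlus hv hw hvw hq hs h
    · obtain ⟨⟨hv0, hw0⟩, -, h⟩ := h
      have hv' : 0 < v.eval env := lt_of_le_of_ne hv fun h => hv0 (holds_eq_zero_iff.2 h.symm)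
      have hw' : 0 < w.eval env := lt_of_le_of_ne hw fun h => hw0 (holds_eq_zero_iff.2 h.symm)
      rcases h with h | h
      · obtain ⟨z, hz⟩ := exists_rimPoint_of_rimFm hv' ht₁ h
        exact ⟨z, mem_prism_of_rimPoint hv' hw' hr.2.2.2 hz⟩
      · obtain ⟨z, hz⟩ := exists_rimPoint_of_rimFm hw' ht₂ h
        exact ⟨z, (mem_prism_of_rimPoint hw' hv' hp.2.2.2 hz).symm⟩
    · rcases hI.1 h with (h | h) | (h | h)
      · exact ⟨_, h, hr⟩
      · exact ⟨_, h, hs⟩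
      · exact ⟨_, hp, h⟩
      · exact ⟨_, hq, h⟩
  · rintro ⟨z, hz₁, hz₂⟩
    by_cases h : (PhiI p q v r s w).Holds env
    · exact .inr h
    have hn := mt hI.2 h
    push Not at hn
    obtain ⟨⟨hr', hs'⟩, hp', hq'⟩ := hn
    have ht₁ := fst_lt_of_not_mem hp' hz₁ hz₂
    have ht₂ := fst_lt_of_not_mem hr' hz₂ hz₁
    -- Two resting beads with a common point stand over the same place, and the later of their
    -- origins lies in the other bead.
    have hvw : v.eval env + w.eval env ≠ 0 := by
      intro h0
      have hv0 : v.eval env = 0 := by linarith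
      have hw0 : w.eval env = 0 := by linarith
      rw [hv0] at hz₁ hr'
      rw [hw0] at hz₂ hp'
      rw [mem_prism_zero_iff] at *
      obtain ⟨⟨a₁, a₂⟩, a₃, a₄⟩ := hz₁
      obtain ⟨⟨c₁, c₂⟩, c₃, c₄⟩ := hz₂
      rcases le_total (p.val env).1 (r.val env).1 with hle | hle
      · exact hr' ⟨⟨a₁.trans c₁.symm, a₂.trans c₁.symm⟩, hle, c₃.trans a₄⟩
      · exact hp' ⟨⟨c₁.trans a₁.symm, c₂.trans a₁.symm⟩, hle, a₃.trans c₄⟩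
    have hfirst : FirstContact (p.val env) (q.val env) (v.eval env) (r.val env) (s.val env)
        (w.eval env) → (PhiIII p q v r s w).Holds env := fun hc =>
      ⟨mt holds_eq_zero_iff.1 hvw, h, .inl (holds_psiICMinus_of_firstContact hv hw hvw hc)⟩
    have hlast : LastContact (p.val env) (q.val env) (v.eval env) (r.val env) (s.val env)
        (w.eval env) → (PhiIII p q v r s w).Holds env := fun hc =>
      ⟨mt holds_eq_zero_iff.1 hvw, h, .inr (holds_psiICPlus_of_lastContact hv hw hvw hc)⟩
    have hE : 1 < Module.rank ℝ ℂ := by rw [Complex.rank_real_complex]; exact Cardinal.one_lt_two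
    refine .inl ⟨⟨ht₁, ht₂⟩, ?_⟩
    rcases contact_or_rimMantel hE hv hw hvw hp' hq' hr' hs' ⟨z, hz₁, hz₂⟩ with
      hc | hc | ⟨hv', hw', hc | hc⟩
    · exact .inl (hfirst hc)
    · exact .inl (hlast hc)
    · rcases rimFm_or_contact hv' hw' ht₁ hp' hq' hr' hs' hc with hc | hc | hc
      · exact .inr ⟨⟨mt holds_eq_zero_iff.1 hv'.ne', mt holds_eq_zero_iff.1 hw'.ne'⟩, h, .inl hc⟩
      · exact .inl (hfirst hc)
      · exact .inl (hlast hc)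
    · rcases rimFm_or_contact hw' hv' ht₂ hr' hs' hp' hq' hc with hc | hc | hc
      · exact .inr ⟨⟨mt holds_eq_zero_iff.1 hv'.ne', mt holds_eq_zero_iff.1 hw'.ne'⟩, h, .inr hc⟩
      · exact .inl (hfirst hc.swap)
      · exact .inl (hlast hc.swap)

end Formula
end Alibi

theorem mainTheorem3 (t₁ x₁ y₁ t₂ x₂ y₂ v₁ t₃ x₃ y₃ t₄ x₄ y₄ v₂ : ℝ)
    (ht₁₂ : t₁ ≤ t₂) (ht₃₄ : t₃ ≤ t₄) (hv₁ : 0 ≤ v₁) (hv₂ : 0 ≤ v₂)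
    (hB₁ : (Alibi.bead t₁ x₁ y₁ t₂ x₂ y₂ v₁).Nonempty)
    (hB₂ : (Alibi.bead t₃ x₃ y₃ t₄ x₄ y₄ v₂).Nonempty) :
    Alibi.psiAlibi.Holds ![t₁, x₁, y₁, t₂, x₂, y₂, v₁, t₃, x₃, y₃, t₄, x₄, y₄, v₂] ↔
      Alibi.bead t₁ x₁ y₁ t₂ x₂ y₂ v₁ ∩ Alibi.bead t₃ x₃ y₃ t₄ x₄ y₄ v₂ = ∅ := by
  have key := Alibi.holds_psiAlibiTm_iff (p := ⟨.var 0, .var 1, .var 2⟩)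
    (q := ⟨.var 3, .var 4, .var 5⟩) (v := .var 6) (r := ⟨.var 7, .var 8, .var 9⟩)
    (s := ⟨.var 10, .var 11, .var 12⟩) (w := .var 13)
    (env := ![t₁, x₁, y₁, t₂, x₂, y₂, v₁, t₃, x₃, y₃, t₄, x₄, y₄, v₂])
  simp only [Alibi.Pt.val, Alibi.Tm.eval_var] at key
  change 0 ≤ v₁ → 0 ≤ v₂ → (Alibi.prism (t₁, (⟨x₁, y₁⟩ : ℂ)) (t₂, (⟨x₂, y₂⟩ : ℂ)) v₁).Nonempty →
    (Alibi.prism (t₃, (⟨x₃, y₃⟩ : ℂ)) (t₄, (⟨x₄, y₄⟩ : ℂ)) v₂).Nonempty → (Alibi.psiAlibi.Holds _ ↔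
      Alibi.prism (t₁, (⟨x₁, y₁⟩ : ℂ)) (t₂, (⟨x₂, y₂⟩ : ℂ)) v₁ ∩
        Alibi.prism (t₃, (⟨x₃, y₃⟩ : ℂ)) (t₄, (⟨x₄, y₄⟩ : ℂ)) v₂ = ∅) at key
  obtain ⟨a, ha⟩ := hB₁
  obtain ⟨b, hb⟩ := hB₂
  rw [key hv₁ hv₂ ⟨_, (Alibi.mem_bead_iff hv₁).1 ha⟩ ⟨_, (Alibi.mem_bead_iff hv₂).1 hb⟩,
    Set.eq_empty_iff_forall_notMem, Set.eq_empty_iff_forall_notMem]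
  constructor
  · rintro h ⟨t, x, y⟩ ⟨h₁, h₂⟩
    exact h _ ⟨(Alibi.mem_bead_iff hv₁).1 h₁, (Alibi.mem_bead_iff hv₂).1 h₂⟩
  · rintro h ⟨t, x, y⟩ ⟨h₁, h₂⟩
    exact h (t, x, y) ⟨(Alibi.mem_bead_iff hv₁).2 h₁, (Alibi.mem_bead_iff hv₂).2 h₂⟩
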